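/- Let $\mathbb{K}$ be an algebraically closed field of characteristic $\neq 2$ and $V$ a $\mathbb{K}$-vector space of finite dimension $r$ with a non-degenerate symmetric bilinear form $b$. Let $\mathbb{K}[\epsilon]$, $\epsilon^2=0$, be the dual numbers and equip $V\oplus\epsilon V=V\otimes\mathbb{K}[\epsilon]$ with the quadratic form $q_2(a+\epsilon c)=b(a,a)+2\epsilon\, b(a,c)$. Let $\mathrm{OGr}(r,V\oplus\epsilon V)$ be the variety of $r$-dimensional $\mathbb{K}$-subspaces of $V\oplus\epsilon V$ that are isotropic for the $\mathbb{K}$-valued form given by the $\epsilon$-coefficient of $q_2$, and let $$\mathrm{O}\Sigma=\{L\in\mathrm{OGr}(r,V\oplus\epsilon V)\mid \epsilon L\subset L\},$$ the variety of Lagrangian $\mathbb{K}[\epsilon]$-submodules, i.e. of $r$-dimensional submodules on which $q_2$ vanishes. Let $\mathrm{OGr}^{(0)}$ be the connected component of $\mathrm{OGr}(r,V\oplus\epsilon V)$ containing $\epsilon V$, let $\mathrm{OGr}^{(1)}$ be its complement in $\mathrm{OGr}(r,V\oplus\epsilon V)$, and for $m=0,1$ put $\mathrm{O}\Sigma^{(m)}=\mathrm{O}\Sigma\cap\mathrm{OGr}^{(m)}$.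 With $\pi:V\oplus\epsilon V\to V$ the projection, let $\mathrm{O}\Sigma_i=\{L\in\mathrm{O}\Sigma\mid\dim\pi(L)=i\}$, and let $\mathrm{OGr}(i,V)$ be the variety of $i$-dimensional isotropic subspaces of $V$. All topological notions refer to the Zariski topology, and all subvarieties carry the reduced structure. Then: (0) $\mathrm{OGr}^{(0)}$ is a connected component of $\mathrm{OGr}(r,V\oplus\epsilon V)$, and if $r\ge 1$ so is $\mathrm{OGr}^{(1)}$ (in particular it is non-empty). $\mathrm{O}\Sigma^{(0)}$ is a connected component of $\mathrm{O}\Sigma$, and if $r\ge 3$ so is $\mathrm{O}\Sigma^{(1)}$ (in particular it is non-empty). (1) For $m=0,1$, $$\mathrm{O}\Sigma^{(m)}=\bigsqcup_{i\equiv m\ (2),\ i\le\lfloor r/2\rfloor}\mathrm{O}\Sigma_i ,$$ the union being disjoint. For each $i\le\lfloor r/2\rfloor$ the map $L\mapsto F=\pi(L)$ makes $\mathrm{O}\Sigma_i$ the total space of an algebraic (Zariski locally trivial) vector bundle over $\mathrm{OGr}(i,V)$ with fiber $\Lambda^2F^*$ over $F$, where $\omega\in\Lambda^2F^*$ corresponds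 to the submodule $L=\{a+\epsilon c\mid a\in F,\ b(c,f)=\omega(a,f)\ \forall f\in F\}$. This correspondence is an isomorphism of varieties from the total space of the bundle $\Lambda^2S^*$, where $S$ is the tautological subbundle on $\mathrm{OGr}(i,V)$, onto $\mathrm{O}\Sigma_i$. (2) For every integer $0\le l\le\lfloor r/2\rfloor$, the closure of $\mathrm{O}\Sigma_l$ (in the Grassmannian of $r$-dimensional subspaces of $V\oplus\epsilon V$; hence also in $\mathrm{O}\Sigma^{(m)}$, where $m\equiv l \bmod 2$) is $$\overline{\mathrm{O}\Sigma}_l=\bigsqcup_{i\equiv l\ (2),\ i\le l}\mathrm{O}\Sigma_i .$$ -/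

import Mathlib

universe u v w w'

namespace LagrangianDual

/-! ### Zariski topology and regular maps (classical varieties, via charts by affine spaces) -/

section Affine

variable (K : Type u) [Field K]

/-- The algebra of polynomial functions on a vector space `E`: the algebra of functions generated
by the linear forms. -/
def polyFun (E : Type v) [AddCommGroup E] [Module K E] : Subalgebra K (E → K) :=
  Algebra.adjoin K (Set.range fun l : Module.Dual K E => (l : E → K))

/-- A map of vector spaces is polynomial if all its coordinates are polynomial functions. -/
def IsPolyMap {E : Type v} {F : Type w} [AddCommGroup E] [Module K E] [AddCommGroup F] [Module K F]
    (p : E → F) : Prop :=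
  ∀ l : Module.Dual K F, (fun x => l (p x)) ∈ polyFun K E

/-- The Zariski topology on a vector space `E`: a basis of it is formed by the
principal open sets `{q ≠ 0}`, for `q` a polynomial function. -/
@[reducible] def zariski (E : Type v) [AddCommGroup E] [Module K E] : TopologicalSpace E :=
  TopologicalSpace.generateFrom {U | ∃ q ∈ polyFun K E, U = {x | q x ≠ 0}}

/-- A covering of a set `X` by charts that are affine spaces `𝔸ⁿ` (finite-dimensional `K`-vector
spaces). It endows `X` with a Zariski topology and a notion of regular map. -/
structure AffineAtlas (X : Type v) where
  Idx : Type w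
  Coord : Idx → Type w'
  [instAddCommGroup : ∀ i, AddCommGroup (Coord i)]
  [instModule : ∀ i, Module K (Coord i)]
  [instFinite : ∀ i, FiniteDimensional K (Coord i)]
  chart : ∀ i, Coord i → X
  chart_injective : ∀ i, Function.Injective (chart i)
  covers : ∀ x, ∃ i, x ∈ Set.range (chart i)

attribute [instance] AffineAtlas.instAddCommGroup AffineAtlas.instModule AffineAtlas.instFinite

variable {K}

/-- The Zariski topology of `X`: a set is open if and only if its trace on every chart is. -/
@[reducible] def AffineAtlas.topology {X : Type v} (𝒜 : AffineAtlas.{u, v, w, w'} K X) : TopologicalSpace X :=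
  ⨆ i, TopologicalSpace.coinduced (𝒜.chart i) (zariski K (𝒜.Coord i))

/-- The affine space `E`, with its identity chart. -/
def affineSpace (E : Type v) [AddCommGroup E] [Module K E] [FiniteDimensional K E] :
    AffineAtlas.{u, v, 0, v} K E where
  Idx := Unit
  Coord := fun _ => E
  chart := fun _ x => x
  chart_injective := fun _ _ _ h => h
  covers := fun x => ⟨(), x, rfl⟩

/-- The product of two varieties, with the products of charts as charts. -/
def AffineAtlas.prod {X Y : Type*} (𝒜 : AffineAtlas K X) (ℬ : AffineAtlas K Y) :
    AffineAtlas K (X × Y) where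
  Idx := 𝒜.Idx × ℬ.Idx
  Coord := fun i => 𝒜.Coord i.1 × ℬ.Coord i.2
  chart := fun i => Prod.map (𝒜.chart i.1) (ℬ.chart i.2)
  chart_injective := fun i => (𝒜.chart_injective i.1).prodMap (ℬ.chart_injective i.2)
  covers := by
    rintro ⟨x, y⟩
    obtain ⟨i, a, rfl⟩ := 𝒜.covers x
    obtain ⟨j, c, rfl⟩ := ℬ.covers y
    exact ⟨(i, j), (a, c), rfl⟩

/-- Regular maps (morphisms of varieties) from a subvariety `S` of `X` to `Y`: near each
point of `S` the map is given, in charts, by quotients of polynomials with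
nonvanishing denominator. -/
def IsRegularMap {X Y : Type*} (𝒜 : AffineAtlas K X) (ℬ : AffineAtlas K Y) (S : Set X)
    (f : S → Y) : Prop :=
  ∀ x : S, ∃ (i : 𝒜.Idx) (c : 𝒜.Coord i) (j : ℬ.Idx) (p : 𝒜.Coord i → ℬ.Coord j)
    (q : 𝒜.Coord i → K),
    𝒜.chart i c = x ∧ IsPolyMap K p ∧ q ∈ polyFun K (𝒜.Coord i) ∧ q c ≠ 0 ∧
    ∀ (z : 𝒜.Coord i) (hz : 𝒜.chart i z ∈ S), q z ≠ 0 →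
      f ⟨𝒜.chart i z, hz⟩ = ℬ.chart j ((q z)⁻¹ • p z)

/-- Isomorphisms of varieties between subvarieties `S` of `X` and `T` of `Y`: bijections that are
regular in both directions. -/
def IsBiregular {X Y : Type*} (𝒜 : AffineAtlas K X) (ℬ : AffineAtlas K Y) {S : Set X} {T : Set Y}
    (e : S ≃ T) : Prop :=
  IsRegularMap 𝒜 ℬ S (fun x => (e x : Y)) ∧ IsRegularMap ℬ 𝒜 T (fun y => (e.symm y : X))

/-- `S` is, through the bijection `e`, the total space of an algebraic vector bundle over `T` whose
fiber at `y ∈ T` is the vector space `Fib y`: the projection `S → T` is regular, and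
over a neighborhood `U` of any point of `T` there are linear isomorphisms
`τ y : Fib y ≃ Kⁿ` under which `S|_U` becomes isomorphic to `(T ∩ U) × Kⁿ` as a variety. -/
def IsAlgVectorBundle {X Y : Type*} (𝒜 : AffineAtlas K X) (S : Set X) (ℬ : AffineAtlas K Y)
    (T : Set Y) (Fib : Y → Type*) [∀ y, AddCommGroup (Fib y)] [∀ y, Module K (Fib y)]
    (e : {t : Sigma Fib | t.1 ∈ T} ≃ S) : Prop :=
  IsRegularMap 𝒜 ℬ S (fun s => (e.symm s).1.1) ∧
  ∀ t₀ ∈ T, ∃ U : Set Y, @IsOpen Y ℬ.topology U ∧ t₀ ∈ U ∧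
    ∃ (n : ℕ) (τ : ∀ y, y ∈ T ∩ U → (Fib y ≃ₗ[K] (Fin n → K))),
      IsRegularMap 𝒜 (affineSpace (Fin n → K))
        {x | ∃ h : x ∈ S, (e.symm ⟨x, h⟩).1.1 ∈ U}
        (fun x => τ (e.symm ⟨x.1, x.2.fst⟩).1.1 ⟨(e.symm ⟨x.1, x.2.fst⟩).2, x.2.snd⟩
          (e.symm ⟨x.1, x.2.fst⟩).1.2) ∧
      IsRegularMap (ℬ.prod (affineSpace (Fin n → K))) 𝒜 ((T ∩ U) ×ˢ Set.univ)
        (fun z => (e ⟨⟨z.1.1, (τ z.1.1 z.2.1).symm z.1.2⟩, z.2.1.1⟩ : X))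

end Affine

/-! ### Grassmannians -/

section Grassmannian

/-- The Grassmannian `Gr(n, W)` of `n`-dimensional subspaces of `W`. -/
@[ext]
structure Gr (K : Type u) [Field K] (n : ℕ) (W : Type v) [AddCommGroup W] [Module K W] where
  toSubmodule : Submodule K W
  finrank_eq : Module.finrank K toSubmodule = n

variable {K : Type u} [Field K] {n : ℕ} {W : Type v} [AddCommGroup W] [Module K W]

/-- A decomposition `W = A ⊕ B` with `dim A = n`. -/
structure Splitting (K : Type u) [Field K] (n : ℕ) (W : Type v) [AddCommGroup W] [Module K W] where
  A : Submodule K W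
  B : Submodule K W
  isCompl : IsCompl A B
  finrank_eq : Module.finrank K A = n

/-- The embedding `A → W`, `a ↦ a + φ a`, whose image is the graph of `φ : A → B`. -/
def Splitting.graphMap (D : Splitting K n W) (φ : D.A →ₗ[K] D.B) : D.A →ₗ[K] W :=
  D.A.subtype + D.B.subtype ∘ₗ φ

theorem Splitting.eq_of_graphMap_eq (D : Splitting K n W) {φ ψ : D.A →ₗ[K] D.B} {x y : D.A}
    (h : D.graphMap φ x = D.graphMap ψ y) : x = y ∧ φ x = ψ y := by
  simp only [Splitting.graphMap, LinearMap.add_apply, LinearMap.comp_apply,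
    Submodule.subtype_apply] at h
  have h1 : (x : W) - y = (ψ y : W) - φ x := by
    rw [sub_eq_sub_iff_add_eq_add, h, add_comm]
  have hA : (x : W) - y ∈ D.A := sub_mem x.2 y.2
  have hB : (x : W) - y ∈ D.B := h1 ▸ sub_mem (ψ y).2 (φ x).2
  have h0 : (x : W) - y = 0 := Submodule.disjoint_def.1 D.isCompl.disjoint _ hA hB
  refine ⟨Subtype.ext (sub_eq_zero.1 h0), Subtype.ext ?_⟩
  rw [h0] at h1
  exact (sub_eq_zero.1 h1.symm).symm

theorem Splitting.graphMap_injective (D : Splitting K n W) (φ : D.A →ₗ[K] D.B) :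
    Function.Injective (D.graphMap φ) :=
  fun _ _ h => (D.eq_of_graphMap_eq h).1

/-- The graph of `φ : A → B`, as a point of the Grassmannian. -/
def Splitting.graph (D : Splitting K n W) (φ : D.A →ₗ[K] D.B) : Gr K n W where
  toSubmodule := LinearMap.range (D.graphMap φ)
  finrank_eq := by
    rw [LinearMap.finrank_range_of_inj (D.graphMap_injective φ), D.finrank_eq]

/-- The isomorphism of `A` with the graph of `φ : A → B`. -/
noncomputable def Splitting.frame (D : Splitting K n W) (φ : D.A →ₗ[K] D.B) :
    D.A ≃ₗ[K] (D.graph φ).toSubmodule :=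
  LinearEquiv.ofInjective (D.graphMap φ) (D.graphMap_injective φ)

theorem Splitting.graph_injective (D : Splitting K n W) : Function.Injective D.graph := by
  intro φ ψ h
  ext1 x
  have hx : D.graphMap φ x ∈ LinearMap.range (D.graphMap ψ) := by
    have h' : LinearMap.range (D.graphMap φ) = LinearMap.range (D.graphMap ψ) :=
      congrArg Gr.toSubmodule h
    exact h' ▸ LinearMap.mem_range_self _ x
  obtain ⟨y, hy⟩ := hx
  obtain ⟨rfl, h2⟩ := D.eq_of_graphMap_eq hy
  exact h2.symm

theorem Gr.exists_splitting (L : Gr K n W) :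
    ∃ (D : Splitting K n W), D.graph 0 = L := by
  obtain ⟨B, hB⟩ := Submodule.exists_isCompl L.toSubmodule
  refine ⟨⟨L.toSubmodule, B, hB, L.finrank_eq⟩, ?_⟩
  ext1
  simp [Splitting.graph, Splitting.graphMap]

/-- The standard charts of the Grassmannian: for each decomposition `W = A ⊕ B` with `dim A = n`,
the subspaces complementary to `B` are the graphs of the linear maps `A → B`. -/
def Gr.atlas (K : Type u) [Field K] (n : ℕ) (W : Type v) [AddCommGroup W] [Module K W]
    [FiniteDimensional K W] : AffineAtlas.{u, v, v, v} K (Gr K n W) where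
  Idx := Splitting K n W
  Coord := fun D => D.A →ₗ[K] D.B
  chart := fun D φ => D.graph φ
  chart_injective := fun D => D.graph_injective
  covers := fun L => by
    obtain ⟨D, hD⟩ := L.exists_splitting
    exact ⟨D, 0, hD⟩

/-- The Zariski topology of the Grassmannian. -/
instance [FiniteDimensional K W] : TopologicalSpace (Gr K n W) := (Gr.atlas K n W).topology

/-- The vector space `Λ²F*` of alternating bilinear forms on `F` (equivalently, away from
characteristic two, of skew-symmetric maps `F → F*`). -/
abbrev Alt2 (F : Gr K n W) : Type (max u v) := F.toSubmodule [⋀^Fin 2]→ₗ[K] K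

/-- The total space of the vector bundle `Λ²S*` over `Gr(n, W)`, where `S` is the tautological
subbundle: over a standard chart it is trivialized by the isomorphisms `A ≃ F`,
`a ↦ a + φ a`, for `F` the graph of `φ`. -/
noncomputable def altAtlas (K : Type u) [Field K] (n : ℕ) (W : Type v) [AddCommGroup W]
    [Module K W] [FiniteDimensional K W] :
    AffineAtlas.{u, max u v, v, max u v} K (Σ F : Gr K n W, Alt2 F) where
  Idx := Splitting K n W
  Coord := fun D => (D.A →ₗ[K] D.B) × (D.A [⋀^Fin 2]→ₗ[K] K)
  instFinite := fun D => by
    have : FiniteDimensional K (D.A [⋀^Fin 2]→ₗ[K] K) :=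
      FiniteDimensional.of_injective
        (AlternatingMap.toMultilinearMapLM (R := K) (S := K) (M := D.A) (N := K) (ι := Fin 2))
        AlternatingMap.coe_multilinearMap_injective
    infer_instance
  chart := fun D c =>
    ⟨D.graph c.1, c.2.compLinearMap (D.frame c.1).symm.toLinearMap⟩
  chart_injective := by
    rintro D ⟨φ, η⟩ ⟨ψ, θ⟩ h
    have h1 : φ = ψ := D.graph_injective (congrArg Sigma.fst h)
    subst h1
    have h2 := eq_of_heq (Sigma.mk.inj h).2
    have h3 := congrArg (fun ω : Alt2 (D.graph φ) => ω.compLinearMap (D.frame φ).toLinearMap) h2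
    have h4 : η = θ := by
      ext x
      have := congrArg (fun ω : D.A [⋀^Fin 2]→ₗ[K] K => ω x) h3
      simpa using this
    rw [h4]
  covers := by
    rintro ⟨F, ω⟩
    obtain ⟨D, rfl⟩ := F.exists_splitting
    refine ⟨D, (0, ω.compLinearMap (D.frame 0).toLinearMap), ?_⟩
    refine Sigma.ext rfl (heq_of_eq ?_)
    ext x
    simp

end Grassmannian

/-! ### Lagrangian submodules of `V ⊕ εV` -/

section Lagrangian

variable {K : Type u} [Field K] {V : Type v} [AddCommGroup V] [Module K V]

/-- Multiplication by `ε` on `V ⊕ εV`, where `(a, c) : V × V` stands for `a + εc`. -/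
def eps (K : Type u) [Field K] (V : Type v) [AddCommGroup V] [Module K V] :
    V × V →ₗ[K] V × V :=
  LinearMap.inr K V V ∘ₗ LinearMap.fst K V V

/-- The `K[ε]`-bilinear extension of the form `b` to `V ⊕ εV`, with values in `K[ε]`. -/
def b₂ (b : LinearMap.BilinForm K V) (x y : V × V) : DualNumber K :=
  TrivSqZeroExt.inl (b x.1 y.1) + TrivSqZeroExt.inr (b x.1 y.2 + b x.2 y.1)

/-- The quadratic form `q₂(a + εc) = q₁(a) + 2ε b(a, c)` on `V ⊕ εV`, where `q₁(a) = b(a, a)`. -/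
def q₂ (b : LinearMap.BilinForm K V) (x : V × V) : DualNumber K := b₂ b x x

/-- Lagrangian `K[ε]`-submodules of `V ⊕ εV`. -/
structure IsLagrangianSubmodule (b : LinearMap.BilinForm K V) (L : Submodule K (V × V)) :
    Prop where
  eps_le : L.map (eps K V) ≤ L
  isotropic : ∀ x ∈ L, q₂ b x = 0
  finrank_eq : Module.finrank K L = Module.finrank K V

/-- The orthogonal Grassmannian `OGr(i, V)` of isotropic subspaces of dimension `i` of `V`. -/
def OGr (b : LinearMap.BilinForm K V) (i : ℕ) : Set (Gr K i V) :=
  {F | ∀ x ∈ F.toSubmodule, b x x = 0}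

/-- The orthogonal Grassmannian `OGr(r, V ⊕ εV)`, `r = dim V`, of Lagrangian subspaces of the
`K`-vector space `V ⊕ εV` with its `K`-valued quadratic form, the coefficient of `ε` in `q₂`. -/
def OGrEps (b : LinearMap.BilinForm K V) : Set (Gr K (Module.finrank K V) (V × V)) :=
  {L | ∀ x ∈ L.toSubmodule, (q₂ b x).snd = 0}

/-- The variety `OΣ` of points `L` of `OGr(r, V ⊕ εV)` with `εL ⊆ L`. -/
def OSigma (b : LinearMap.BilinForm K V) : Set (Gr K (Module.finrank K V) (V × V)) :=
  {L | L ∈ OGrEps b ∧ L.toSubmodule.map (eps K V) ≤ L.toSubmodule}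

/-- `OΣ` consists of all Lagrangian `K[ε]`-submodules of `V ⊕ εV`. -/
theorem mem_OSigma_iff (hK : ringChar K ≠ 2) (b : LinearMap.BilinForm K V)
    (L : Gr K (Module.finrank K V) (V × V)) :
    L ∈ OSigma b ↔ IsLagrangianSubmodule b L.toSubmodule := by
  constructor
  · rintro ⟨h1, h2⟩
    refine ⟨h2, fun x hx => ?_, L.finrank_eq⟩
    have h3 : (0, x.1) ∈ L.toSubmodule :=
      h2 ⟨x, hx, by simp [eps]⟩
    have h4 := h1 _ (L.toSubmodule.add_mem hx h3)
    have h5 := h1 _ hx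
    have h2' : (2 : K) ≠ 0 := Ring.two_ne_zero hK
    ext
    · simp only [q₂, b₂, TrivSqZeroExt.snd_add, TrivSqZeroExt.snd_inl, TrivSqZeroExt.snd_inr,
        Prod.fst_add, Prod.snd_add, add_zero, map_add, LinearMap.add_apply, zero_add] at h4 h5
      have h6 : (2 : K) * b x.1 x.1 = 0 := by linear_combination h4 - h5
      simpa [q₂, b₂] using (mul_eq_zero.1 h6).resolve_left h2'
    · simpa using h5
  · rintro ⟨h1, h2, -⟩
    exact ⟨fun x hx => by rw [h2 x hx]; rfl, h1⟩

/-- The point `[εV]` of `OGr(r, V ⊕ εV)`. -/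
def epsV (K : Type u) [Field K] (V : Type v) [AddCommGroup V] [Module K V] :
    Gr K (Module.finrank K V) (V × V) where
  toSubmodule := LinearMap.range (LinearMap.inr K V V)
  finrank_eq := LinearMap.finrank_range_of_inj LinearMap.inr_injective

/-- `OGr⁽⁰⁾` is the connected component of `OGr(r, V ⊕ εV)` that contains `[εV]`, and `OGr⁽¹⁾` is
the rest of `OGr(r, V ⊕ εV)`. -/
def OGrComp [FiniteDimensional K V] (b : LinearMap.BilinForm K V) (m : Fin 2) :
    Set (Gr K (Module.finrank K V) (V × V)) :=
  if m = 0 then connectedComponentIn (OGrEps b) (epsV K V)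
  else OGrEps b \ connectedComponentIn (OGrEps b) (epsV K V)

/-- `OΣ⁽ᵐ⁾ = OΣ ∩ OGr⁽ᵐ⁾`. -/
def OSigmaComp [FiniteDimensional K V] (b : LinearMap.BilinForm K V) (m : Fin 2) :
    Set (Gr K (Module.finrank K V) (V × V)) :=
  OSigma b ∩ OGrComp b m

/-- The stratum `OΣᵢ` of all `L` in `OΣ` whose image `F = π(L)` under the projection
`π : V ⊕ εV → V` has dimension `i`. -/
def OSigmaStratum (b : LinearMap.BilinForm K V) (i : ℕ) :
    Set (Gr K (Module.finrank K V) (V × V)) :=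
  {L | L ∈ OSigma b ∧ Module.finrank K (L.toSubmodule.map (LinearMap.fst K V V)) = i}

/-- The subspace of all `a + εc` with `a ∈ F` such that the class of `c` in `V / F^⊥ = F*` is
`ω(a, ·)`, for `ω ∈ Λ²F*`. -/
def extensionOf (b : LinearMap.BilinForm K V) {i : ℕ} (F : Gr K i V) (ω : Alt2 F) :
    Submodule K (V × V) where
  carrier := {x | ∃ h : x.1 ∈ F.toSubmodule, ∀ f : F.toSubmodule, b x.2 f = ω ![⟨x.1, h⟩, f]}
  zero_mem' := ⟨F.toSubmodule.zero_mem, fun f => by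
    have h : ω ![0, f] = 0 := ω.map_coord_zero 0 (by simp)
    exact (by simp : b 0 f = 0).trans h.symm⟩
  add_mem' := by
    rintro x y ⟨hx, hx'⟩ ⟨hy, hy'⟩
    refine ⟨F.toSubmodule.add_mem hx hy, fun f => ?_⟩
    have h := ω.map_vecCons_add ![f] ⟨x.1, hx⟩ ⟨y.1, hy⟩
    rw [Prod.snd_add, map_add, LinearMap.add_apply, hx', hy', ← h]
    rfl
  smul_mem' := by
    rintro c x ⟨hx, hx'⟩
    refine ⟨F.toSubmodule.smul_mem c hx, fun f => ?_⟩
    have h := ω.map_vecCons_smul ![f] c ⟨x.1, hx⟩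
    rw [Prod.smul_snd, map_smul, LinearMap.smul_apply, hx', ← h]
    rfl

end Lagrangian

end LagrangianDual

open LagrangianDual

/-! The ε-coefficient of `q₂` is 2b(a, c), and b identifies the second copy of V with V*. So V ⊕ εV
is the hyperbolic space V ⊕ V*, whose Lagrangian subspaces are the pairs (F, ω) with F = π(L) and ω
an alternating form on F (`exists_eq_extGr`). The vertical part of L is F^⊥, hence εL ⊆ L means
exactly that F is isotropic for b (`mem_OSigma_iff_baseOf`). This turns every assertion about OΣ
into one about pairs (F, ω).

Components. The parity of dim F is locally constant: for G a complement of F^⊥, L is transversal to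
the Lagrangian G^⊥ ⊕ εG. Transversality is open, and whenever it holds ω is nondegenerate on F ∩
G^⊥, whose even dimension is dim F - dim G (`even_finrank_baseOf_add`, `exists_open_parity`).
Conversely, points of equal parity are joined by rational curves: affine lines in the fibers Λ²F*,
and orbits of the unipotent maps 1 + sN, with N the shear attached to p₁ ∧ p₂, which enlarge F by
⟨p₁, p₂⟩ as soon as s ≠ 0 (`baseOf_shearGr`). These curves never leave the Lagrangians whose
projection lies in the largest F involved, so they stay in OΣ if they start there. They reduce dim F
to 0, where only εV is left, or to 1, where lines of V remain to be connected. Arbitrary lines are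
joined by pencils; isotropic lines are joined by conics, which requires r ≥ 3
(`connectedThrough_lineGr_of_not_orthogonal`).

Closures. Letting s tend to 0 in a shear by p₁, p₂ with F + ⟨p₁, p₂⟩ isotropic puts each stratum in
the closure of the stratum two steps up. Nothing else enters a closure, because OΣ is closed, the
parity is locally constant and dim π(L) is lower semicontinuous.

Bundle structure. In charts, (F, ω) ↦ L is the kernel of a polynomial family of linear maps
(`rational_extChart`), and the inverse is read off from a moving frame of L
(`rational_coordinates`). By Cramer's rule both are quotients of polynomials. -/

namespace LagrangianDual

/-! ### Polynomial and rational maps between vector spaces -/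

section PolynomialCalculus

open Module

variable {K : Type u} [Field K]
variable {E : Type*} [AddCommGroup E] [Module K E]
variable {F : Type*} [AddCommGroup F] [Module K F]
variable {G : Type*} [AddCommGroup G] [Module K G]
variable {H : Type*} [AddCommGroup H] [Module K H]

theorem const_mem_polyFun (c : K) : (fun _ => c : E → K) ∈ polyFun K E :=
  (polyFun K E).algebraMap_mem c

theorem dual_mem_polyFun (l : Dual K E) : (fun x => l x) ∈ polyFun K E :=
  Algebra.subset_adjoin ⟨l, rfl⟩

theorem add_mem_polyFun {p q : E → K} (hp : p ∈ polyFun K E) (hq : q ∈ polyFun K E) :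
    (fun x => p x + q x) ∈ polyFun K E := (polyFun K E).add_mem hp hq

theorem mul_mem_polyFun {p q : E → K} (hp : p ∈ polyFun K E) (hq : q ∈ polyFun K E) :
    (fun x => p x * q x) ∈ polyFun K E := (polyFun K E).mul_mem hp hq

theorem sum_mem_polyFun {ι : Type*} (s : Finset ι) {p : ι → E → K}
    (hp : ∀ i ∈ s, p i ∈ polyFun K E) : (fun x => ∑ i ∈ s, p i x) ∈ polyFun K E := by
  have := (polyFun K E).sum_mem hp
  convert this using 1
  ext x; simp

theorem prod_mem_polyFun {ι : Type*} (s : Finset ι) {p : ι → E → K}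
    (hp : ∀ i ∈ s, p i ∈ polyFun K E) : (fun x => ∏ i ∈ s, p i x) ∈ polyFun K E := by
  have := (polyFun K E).prod_mem hp
  convert this using 1
  ext x; simp

theorem polyFun_comp {p : E → F} (hp : IsPolyMap K p) {q : F → K} (hq : q ∈ polyFun K F) :
    (fun x => q (p x)) ∈ polyFun K E := by
  induction hq using Algebra.adjoin_induction with
  | mem q hq => obtain ⟨l, rfl⟩ := hq; exact hp l
  | algebraMap c => exact const_mem_polyFun c
  | add q q' _ _ h h' => exact add_mem_polyFun h h'
  | mul q q' _ _ h h' => exact mul_mem_polyFun h h'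

theorem isPolyMap_iff_mem {q : E → K} : IsPolyMap K q ↔ q ∈ polyFun K E := by
  refine ⟨fun h => h LinearMap.id, fun h l => ?_⟩
  have : (fun x => l (q x)) = fun x => l 1 * q x := by
    ext x
    rw [mul_comm, ← smul_eq_mul, ← map_smul, smul_eq_mul, mul_one]
  rw [this]
  exact mul_mem_polyFun (const_mem_polyFun _) h

theorem IsPolyMap.const (c : F) : IsPolyMap K (fun _ : E => c) := fun l => const_mem_polyFun (l c)

theorem IsPolyMap.linear (f : E →ₗ[K] F) : IsPolyMap K f := fun l => dual_mem_polyFun (l ∘ₗ f)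

theorem IsPolyMap.id : IsPolyMap K (fun x : E => x) := IsPolyMap.linear LinearMap.id

theorem IsPolyMap.comp {g : F → G} {f : E → F} (hg : IsPolyMap K g) (hf : IsPolyMap K f) :
    IsPolyMap K (fun x => g (f x)) := fun l => polyFun_comp hf (hg l)

theorem IsPolyMap.map {f : E → F} (hf : IsPolyMap K f) (g : F →ₗ[K] G) :
    IsPolyMap K (fun x => g (f x)) := (IsPolyMap.linear g).comp hf

theorem IsPolyMap.add {f g : E → F} (hf : IsPolyMap K f) (hg : IsPolyMap K g) :
    IsPolyMap K (fun x => f x + g x) := fun l => by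
  simpa only [map_add] using add_mem_polyFun (hf l) (hg l)

theorem IsPolyMap.neg {f : E → F} (hf : IsPolyMap K f) :
    IsPolyMap K (fun x => -f x) := hf.map (-LinearMap.id)

theorem IsPolyMap.sub {f g : E → F} (hf : IsPolyMap K f) (hg : IsPolyMap K g) :
    IsPolyMap K (fun x => f x - g x) := by
  simpa only [sub_eq_add_neg] using hf.add hg.neg

theorem IsPolyMap.sum {ι : Type*} (s : Finset ι) {f : ι → E → F}
    (hf : ∀ i ∈ s, IsPolyMap K (f i)) : IsPolyMap K (fun x => ∑ i ∈ s, f i x) := fun l => by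
  simpa only [map_sum] using sum_mem_polyFun s fun i hi => hf i hi l

theorem IsPolyMap.smul {c : E → K} {f : E → F} (hc : c ∈ polyFun K E) (hf : IsPolyMap K f) :
    IsPolyMap K (fun x => c x • f x) := fun l => by
  simpa only [map_smul, smul_eq_mul] using mul_mem_polyFun hc (hf l)

theorem IsPolyMap.prodMk {f : E → F} {g : E → G} (hf : IsPolyMap K f) (hg : IsPolyMap K g) :
    IsPolyMap K (fun x => (f x, g x)) := by
  have := (hf.map (LinearMap.inl K F G)).add (hg.map (LinearMap.inr K F G))
  simpa using this

theorem IsPolyMap.map₂ [FiniteDimensional K F] (β : F →ₗ[K] G →ₗ[K] H) {f : E → F} {g : E → G}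
    (hf : IsPolyMap K f) (hg : IsPolyMap K g) : IsPolyMap K (fun x => β (f x) (g x)) := by
  let e := Module.finBasis K F
  have : (fun x => β (f x) (g x)) = fun x => ∑ i, e.coord i (f x) • β (e i) (g x) := by
    ext x
    have h := congrArg (fun y => β y (g x)) (e.sum_repr (f x))
    simp only [map_sum, map_smul, LinearMap.sum_apply, LinearMap.smul_apply] at h
    exact h.symm
  rw [this]
  exact IsPolyMap.sum _ fun i _ => IsPolyMap.smul (hf _) (hg.map _)

/-- A family of linear maps is polynomial if and only if its values on every vector are. -/
theorem IsPolyMap.of_apply [FiniteDimensional K F] {f : E → F →ₗ[K] G}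
    (hf : ∀ v, IsPolyMap K (fun x => f x v)) : IsPolyMap K f := by
  let e := Module.finBasis K F
  have : f = fun x => ∑ i, LinearMap.smulRightₗ (e.coord i) (f x (e i)) := by
    ext x v
    have h := congrArg (f x) (e.sum_repr v)
    simp only [map_sum, map_smul] at h
    simpa [LinearMap.sum_apply] using h.symm
  rw [this]
  exact IsPolyMap.sum _ fun i _ => (hf (e i)).map _

theorem IsPolyMap.apply {f : E → F →ₗ[K] G} (hf : IsPolyMap K f) (v : F) :
    IsPolyMap K (fun x => f x v) := hf.map (LinearMap.applyₗ v)

theorem IsPolyMap.llcomp [FiniteDimensional K F] [FiniteDimensional K G]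
    {f : E → F →ₗ[K] G} {g : E → G →ₗ[K] H} (hg : IsPolyMap K g) (hf : IsPolyMap K f) :
    IsPolyMap K (fun x => g x ∘ₗ f x) :=
  IsPolyMap.map₂ (LinearMap.llcomp K F G H).flip hf hg

theorem det_mem_polyFun {n : Type*} [Fintype n] [DecidableEq n] {f : E → Matrix n n K}
    (hf : ∀ i j, (fun x => f x i j) ∈ polyFun K E) : (fun x => (f x).det) ∈ polyFun K E := by
  simp only [Matrix.det_apply']
  exact sum_mem_polyFun _ fun σ _ => mul_mem_polyFun (const_mem_polyFun _)
    (prod_mem_polyFun _ fun i _ => hf _ _)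

theorem adjugate_mem_polyFun {n : Type*} [Fintype n] [DecidableEq n] {f : E → Matrix n n K}
    (hf : ∀ i j, (fun x => f x i j) ∈ polyFun K E) (i j : n) :
    (fun x => (f x).adjugate i j) ∈ polyFun K E := by
  simp only [Matrix.adjugate_apply]
  refine det_mem_polyFun fun k l => ?_
  by_cases h : k = j
  · subst h
    simpa using const_mem_polyFun _
  · simpa [Matrix.updateRow_ne h] using hf k l

/-! ### Properties that hold on a principal open neighborhood -/

/-- `P` holds on a principal open neighborhood of `z₀`. -/
def NearAt (K : Type u) [Field K] {E : Type*} [AddCommGroup E] [Module K E]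
    (P : E → Prop) (z₀ : E) : Prop :=
  ∃ q ∈ polyFun K E, q z₀ ≠ 0 ∧ ∀ z, q z ≠ 0 → P z

/-- `f` is a quotient of polynomials on a principal open neighborhood of `z₀`. -/
def RationalAt (K : Type u) [Field K] {E : Type*} [AddCommGroup E] [Module K E]
    {F : Type*} [AddCommGroup F] [Module K F] (f : E → F) (z₀ : E) : Prop :=
  ∃ (p : E → F) (q : E → K), IsPolyMap K p ∧ q ∈ polyFun K E ∧ q z₀ ≠ 0 ∧
    ∀ z, q z ≠ 0 → f z = (q z)⁻¹ • p z

theorem NearAt.and {P Q : E → Prop} {z₀ : E} (hP : NearAt K P z₀) (hQ : NearAt K Q z₀) :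
    NearAt K (fun z => P z ∧ Q z) z₀ := by
  obtain ⟨p, hp, hp0, hp'⟩ := hP
  obtain ⟨q, hq, hq0, hq'⟩ := hQ
  exact ⟨fun z => p z * q z, mul_mem_polyFun hp hq, mul_ne_zero hp0 hq0, fun z hz =>
    ⟨hp' z (left_ne_zero_of_mul hz), hq' z (right_ne_zero_of_mul hz)⟩⟩

theorem NearAt.mono {P Q : E → Prop} {z₀ : E} (hP : NearAt K P z₀) (h : ∀ z, P z → Q z) :
    NearAt K Q z₀ := by
  obtain ⟨p, hp, hp0, hp'⟩ := hP
  exact ⟨p, hp, hp0, fun z hz => h z (hp' z hz)⟩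

theorem NearAt.self {P : E → Prop} {z₀ : E} (hP : NearAt K P z₀) : P z₀ := by
  obtain ⟨p, hp, hp0, hp'⟩ := hP
  exact hp' _ hp0

theorem NearAt.of_forall {P : E → Prop} {z₀ : E} (h : ∀ z, P z) : NearAt K P z₀ :=
  ⟨fun _ => 1, const_mem_polyFun 1, one_ne_zero, fun z _ => h z⟩

/-- Multiplying numerator and denominator by the polynomial t that guards P shrinks the domain of
the formula without changing the quotient. A single denominator then controls both, as
`IsRegularMap` demands. -/
theorem RationalAt.exists_and {f : E → F} {z₀ : E} (hf : RationalAt K f z₀) {P : E → Prop}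
    (hP : NearAt K P z₀) : ∃ (p : E → F) (q : E → K), IsPolyMap K p ∧ q ∈ polyFun K E ∧ q z₀ ≠ 0 ∧
      ∀ z, q z ≠ 0 → f z = (q z)⁻¹ • p z ∧ P z := by
  obtain ⟨p, q, hp, hq, hq0, h⟩ := hf
  obtain ⟨t, ht, ht0, h'⟩ := hP
  refine ⟨fun z => t z • p z, fun z => t z * q z, IsPolyMap.smul ht hp, mul_mem_polyFun ht hq,
    mul_ne_zero ht0 hq0, fun z hz => ⟨?_, h' z (left_ne_zero_of_mul hz)⟩⟩
  have h1 := left_ne_zero_of_mul hz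
  have h2 := right_ne_zero_of_mul hz
  rw [h z h2, smul_smul]
  congr 1
  field_simp

theorem IsPolyMap.rationalAt {f : E → F} (hf : IsPolyMap K f) (z₀ : E) : RationalAt K f z₀ :=
  ⟨f, fun _ => 1, hf, const_mem_polyFun 1, one_ne_zero, fun z _ => by simp⟩

theorem RationalAt.map {f : E → F} {z₀ : E} (hf : RationalAt K f z₀) (g : F →ₗ[K] G) :
    RationalAt K (fun z => g (f z)) z₀ := by
  obtain ⟨p, q, hp, hq, hq0, h⟩ := hf
  exact ⟨fun z => g (p z), q, hp.map g, hq, hq0, fun z hz => by simp only [h z hz, map_smul]⟩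

theorem RationalAt.map₂ [FiniteDimensional K F] (β : F →ₗ[K] G →ₗ[K] H) {f : E → F} {g : E → G}
    {z₀ : E} (hf : RationalAt K f z₀) (hg : RationalAt K g z₀) :
    RationalAt K (fun x => β (f x) (g x)) z₀ := by
  obtain ⟨p, q, hp, hq, hq0, h⟩ := hf
  obtain ⟨p', q', hp', hq', hq0', h'⟩ := hg
  refine ⟨fun z => β (p z) (p' z), fun z => q z * q' z, IsPolyMap.map₂ β hp hp',
    mul_mem_polyFun hq hq', mul_ne_zero hq0 hq0', fun z hz => ?_⟩
  simp [h z (left_ne_zero_of_mul hz), h' z (right_ne_zero_of_mul hz), smul_smul, mul_comm]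

theorem RationalAt.add {f g : E → F} {z₀ : E} (hf : RationalAt K f z₀) (hg : RationalAt K g z₀) :
    RationalAt K (fun x => f x + g x) z₀ := by
  obtain ⟨p, q, hp, hq, hq0, h⟩ := hf
  obtain ⟨p', q', hp', hq', hq0', h'⟩ := hg
  refine ⟨fun z => q' z • p z + q z • p' z, fun z => q z * q' z,
    (IsPolyMap.smul hq' hp).add (IsPolyMap.smul hq hp'),
    mul_mem_polyFun hq hq', mul_ne_zero hq0 hq0', fun z hz => ?_⟩
  have h1 := left_ne_zero_of_mul hz
  have h2 := right_ne_zero_of_mul hz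
  simp only [h z h1, h' z h2, smul_add, smul_smul]
  congr 2 <;> field_simp

theorem RationalAt.neg {f : E → F} {z₀ : E} (hf : RationalAt K f z₀) :
    RationalAt K (fun x => -f x) z₀ := hf.map (-LinearMap.id)

theorem RationalAt.prodMk {f : E → F} {g : E → G} {z₀ : E} (hf : RationalAt K f z₀)
    (hg : RationalAt K g z₀) : RationalAt K (fun x => (f x, g x)) z₀ := by
  have := (hf.map (LinearMap.inl K F G)).add (hg.map (LinearMap.inr K F G))
  simpa using this

theorem RationalAt.llcomp [FiniteDimensional K F] [FiniteDimensional K G]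
    {f : E → F →ₗ[K] G} {g : E → G →ₗ[K] H} {z₀ : E}
    (hg : RationalAt K g z₀) (hf : RationalAt K f z₀) :
    RationalAt K (fun x => g x ∘ₗ f x) z₀ :=
  RationalAt.map₂ (LinearMap.llcomp K F G H).flip hf hg

theorem NearAt.comp {P : F → Prop} {g : E → F} {z₀ : E} (hP : NearAt K P (g z₀))
    (hg : IsPolyMap K g) : NearAt K (fun z => P (g z)) z₀ := by
  obtain ⟨q, hq, hq0, h⟩ := hP
  exact ⟨fun z => q (g z), polyFun_comp hg hq, hq0, fun z hz => h _ hz⟩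

theorem RationalAt.comp {f : F → G} {g : E → F} {z₀ : E} (hf : RationalAt K f (g z₀))
    (hg : IsPolyMap K g) : RationalAt K (fun z => f (g z)) z₀ := by
  obtain ⟨p, q, hp, hq, hq0, h⟩ := hf
  exact ⟨fun z => p (g z), fun z => q (g z), hp.comp hg, polyFun_comp hg hq, hq0,
    fun z hz => h _ hz⟩

/-- A polynomial function composed with a rational map becomes polynomial after clearing
denominators. -/
theorem exists_clear_denominators {p : E → F} {q : E → K} (hp : IsPolyMap K p)
    (hq : q ∈ polyFun K E) {t : F → K} (ht : t ∈ polyFun K F) :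
    ∃ t' ∈ polyFun K E, ∃ n : ℕ, ∀ z, q z ≠ 0 → t' z = q z ^ n * t ((q z)⁻¹ • p z) := by
  induction ht using Algebra.adjoin_induction with
  | mem t ht =>
    obtain ⟨l, rfl⟩ := ht
    refine ⟨fun z => l (p z), hp l, 1, fun z hz => ?_⟩
    simp [mul_inv_cancel_left₀ hz]
  | algebraMap c => exact ⟨fun _ => c, const_mem_polyFun c, 0, fun z _ => by simp⟩
  | add t₁ t₂ _ _ h₁ h₂ =>
    obtain ⟨s₁, hs₁, n₁, e₁⟩ := h₁
    obtain ⟨s₂, hs₂, n₂, e₂⟩ := h₂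
    refine ⟨fun z => q z ^ n₂ * s₁ z + q z ^ n₁ * s₂ z,
      add_mem_polyFun (mul_mem_polyFun ((polyFun K E).pow_mem hq _) hs₁)
        (mul_mem_polyFun ((polyFun K E).pow_mem hq _) hs₂), n₁ + n₂, fun z hz => ?_⟩
    simp only [e₁ z hz, e₂ z hz, Pi.add_apply]
    ring
  | mul t₁ t₂ _ _ h₁ h₂ =>
    obtain ⟨s₁, hs₁, n₁, e₁⟩ := h₁
    obtain ⟨s₂, hs₂, n₂, e₂⟩ := h₂
    refine ⟨fun z => s₁ z * s₂ z, mul_mem_polyFun hs₁ hs₂, n₁ + n₂, fun z hz => ?_⟩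
    simp only [e₁ z hz, e₂ z hz, Pi.mul_apply]
    ring

/-- The guard of P, pulled back along f, becomes a polynomial t' once multiplied by a power of the
denominator q. The new guard is q t': the factor q keeps the formula for f valid, and t' keeps the
pulled-back guard nonzero. -/
theorem NearAt.comp_rational {P : F → Prop} {f : E → F} {z₀ : E} (hP : NearAt K P (f z₀))
    (hf : RationalAt K f z₀) : NearAt K (fun z => P (f z)) z₀ := by
  obtain ⟨t, ht, ht0, h⟩ := hP
  obtain ⟨p, q, hp, hq, hq0, h'⟩ := hf
  obtain ⟨t', ht', n, e⟩ := exists_clear_denominators hp hq ht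
  refine ⟨fun z => q z * t' z, mul_mem_polyFun hq ht', ?_, fun z hz => h _ ?_⟩
  · have := h' _ hq0
    rw [this] at ht0
    simp only [e _ hq0]
    exact mul_ne_zero hq0 (mul_ne_zero (pow_ne_zero _ hq0) ht0)
  · have hz1 := left_ne_zero_of_mul hz
    have hz2 := right_ne_zero_of_mul hz
    rw [e z hz1] at hz2
    rw [h' z hz1]
    exact right_ne_zero_of_mul hz2

/-! ### Inverses and injectivity in polynomial families of linear maps -/

section Inverse

variable [FiniteDimensional K F]

theorem linearMap_det_mem_polyFun {f : E → F →ₗ[K] F} (hf : IsPolyMap K f) :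
    (fun z => LinearMap.det (f z)) ∈ polyFun K E := by
  classical
  let e := Module.finBasis K F
  simp only [← LinearMap.det_toMatrix e]
  exact det_mem_polyFun fun i j => by
    simpa [LinearMap.toMatrix_apply] using (hf.apply (e j)) (e.coord i)

theorem NearAt.isUnit {f : E → F →ₗ[K] F} (hf : IsPolyMap K f) {z₀ : E} (h : IsUnit (f z₀)) :
    NearAt K (fun z => IsUnit (f z)) z₀ :=
  ⟨_, linearMap_det_mem_polyFun hf, (LinearMap.isUnit_iff_isUnit_det _).1 h |>.ne_zero,
    fun _ hz => (LinearMap.isUnit_iff_isUnit_det _).2 (isUnit_iff_ne_zero.2 hz)⟩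

/-- Cramer's rule: adjugate over determinant. The default value of `Ring.inverse` at non-units is
harmless, since the formula is claimed only where the determinant is nonzero. -/
theorem RationalAt.ringInverse {f : E → F →ₗ[K] F} (hf : IsPolyMap K f) {z₀ : E}
    (h : IsUnit (f z₀)) : RationalAt K (fun z => Ring.inverse (f z)) z₀ := by
  classical
  let e := Module.finBasis K F
  refine ⟨fun z => Matrix.toLin e e (LinearMap.toMatrix e e (f z)).adjugate,
    fun z => LinearMap.det (f z), ?_, linearMap_det_mem_polyFun hf,
    (LinearMap.isUnit_iff_isUnit_det _).1 h |>.ne_zero, fun z hz => ?_⟩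
  · have h1 : IsPolyMap K fun z => (LinearMap.toMatrix e e (f z)).adjugate := by
      have : (fun z => (LinearMap.toMatrix e e (f z)).adjugate) = fun z => ∑ i, ∑ j,
          (LinearMap.toMatrix e e (f z)).adjugate i j • Matrix.single i j (1 : K) := by
        ext z : 1
        conv_lhs => rw [Matrix.matrix_eq_sum_single (LinearMap.toMatrix e e (f z)).adjugate]
        simp
      rw [this]
      refine IsPolyMap.sum _ fun i _ => IsPolyMap.sum _ fun j _ => IsPolyMap.smul ?_ (.const _)
      exact adjugate_mem_polyFun (fun k l => by
        simpa [LinearMap.toMatrix_apply] using (hf.apply (e l)) (e.coord k)) i j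
    exact h1.map (Matrix.toLin e e).toLinearMap
  · simp only [← LinearMap.det_toMatrix e] at hz ⊢
    have h2 : f z * ((LinearMap.toMatrix e e (f z)).det⁻¹ •
        Matrix.toLin e e (LinearMap.toMatrix e e (f z)).adjugate) = 1 := by
      rw [mul_smul_comm]
      conv_lhs => enter [2, 1]; rw [← Matrix.toLin_toMatrix e e (f z)]
      rw [Module.End.mul_eq_comp, ← Matrix.toLin_mul, Matrix.mul_adjugate, map_smul,
        Matrix.toLin_one, smul_smul, inv_mul_cancel₀ hz, one_smul]
      rfl
    have h3 := mul_eq_one_comm.1 h2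
    have hu : IsUnit (f z) := ⟨⟨_, _, h2, h3⟩, rfl⟩
    exact (left_inv_eq_right_inv (Ring.inverse_mul_cancel _ hu) h2)

/-- Injectivity is an open condition in a polynomial family of linear maps. -/
theorem NearAt.injective {f : E → F →ₗ[K] G} (hf : IsPolyMap K f) {z₀ : E}
    (h : Function.Injective (f z₀)) : NearAt K (fun z => Function.Injective (f z)) z₀ := by
  -- With a fixed left inverse g of `f z₀`, injectivity of `f z` follows from invertibility of the
  -- endomorphism g ∘ `f z`, a determinant condition.
  obtain ⟨g, hg⟩ := LinearMap.exists_leftInverse_of_injective (f z₀) (LinearMap.ker_eq_bot.2 h)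
  have h1 : IsPolyMap K fun z => g ∘ₗ f z := hf.map (LinearMap.llcomp K F G F g)
  refine (NearAt.isUnit h1 (z₀ := z₀) (by rw [hg]; exact isUnit_one)).mono fun _ hz => ?_
  have := ((Module.End.isUnit_iff _).1 hz).1
  exact Function.Injective.of_comp (f := g) (by simpa using this)

end Inverse

/-! ### The Zariski topology of a vector space -/

/-- A product of two polynomials guards the intersection of their principal open sets, so these sets
form a basis and not just a subbasis. -/
theorem isOpen_zariski_iff {U : Set E} :
    @IsOpen E (zariski K E) U ↔ ∀ z ∈ U, NearAt K (· ∈ U) z := by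
  constructor
  · intro h
    induction h with
    | basic U hU =>
      obtain ⟨q, hq, rfl⟩ := hU
      exact fun z hz => ⟨q, hq, hz, fun _ h => h⟩
    | univ => exact fun _ _ => NearAt.of_forall fun _ => trivial
    | inter U V _ _ hU hV => exact fun z hz => (hU z hz.1).and (hV z hz.2)
    | sUnion S _ hS =>
      rintro z ⟨U, hU, hz⟩
      exact (hS U hU z hz).mono fun w hw => ⟨U, hU, hw⟩
  · intro h
    choose! q hq hq0 hqU using h
    have : U = ⋃ z ∈ U, {x | q z x ≠ 0} := by
      ext x
      simp only [Set.mem_iUnion, exists_prop]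
      exact ⟨fun hx => ⟨x, hx, hq0 x hx⟩, fun ⟨z, hz, hx⟩ => hqU z hz x hx⟩
    rw [this]
    let _ := zariski K E
    exact isOpen_biUnion fun z hz => TopologicalSpace.GenerateOpen.basic _ ⟨q z, hq z hz, rfl⟩

/-- Nonempty Zariski open subsets of the affine line are cofinite. -/
theorem finite_compl_of_nearAt {P : K → Prop} {z₀ : K} (h : NearAt K P z₀) :
    {z | ¬ P z}.Finite := by
  obtain ⟨q, hq, hq0, hP⟩ := h
  obtain ⟨f, hf⟩ : ∃ f : Polynomial K, ∀ z, q z = f.eval z := by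
    clear hq0 hP
    induction hq using Algebra.adjoin_induction with
    | mem q hq =>
      obtain ⟨l, rfl⟩ := hq
      refine ⟨Polynomial.C (l 1) * Polynomial.X, fun z => ?_⟩
      have h := l.map_smul z 1
      rw [smul_eq_mul, mul_one, smul_eq_mul] at h
      rw [Polynomial.eval_mul, Polynomial.eval_C, Polynomial.eval_X, mul_comm]
      exact h
    | algebraMap c => exact ⟨Polynomial.C c, fun z => by simp⟩
    | add q q' _ _ h h' =>
      obtain ⟨f, hf⟩ := h
      obtain ⟨f', hf'⟩ := h'
      exact ⟨f + f', fun z => by simp [hf, hf']⟩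
    | mul q q' _ _ h h' =>
      obtain ⟨f, hf⟩ := h
      obtain ⟨f', hf'⟩ := h'
      exact ⟨f * f', fun z => by simp [hf, hf']⟩
  have hf0 : f ≠ 0 := by
    rintro rfl
    exact hq0 (by simp [hf])
  refine (Polynomial.finite_setOfPred_isRoot hf0).subset fun z hz => ?_
  by_contra h
  exact hz (hP z (by rw [hf]; exact h))

/-- Two nonempty open sets are cofinite in an infinite line, hence meet. -/
theorem isPreconnected_univ_zariski_line [Infinite K] :
    @IsPreconnected K (zariski K K) Set.univ := by
  let _ := zariski K K
  rintro U V hU hV - ⟨x, -, hx⟩ ⟨y, -, hy⟩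
  have h1 := finite_compl_of_nearAt (isOpen_zariski_iff.1 hU x hx)
  have h2 := finite_compl_of_nearAt (isOpen_zariski_iff.1 hV y hy)
  obtain ⟨z, hz⟩ := (h1.union h2).infinite_compl.nonempty
  simp only [Set.mem_compl_iff, Set.mem_union, Set.mem_ofPred_eq, not_or, not_not] at hz
  exact ⟨z, trivial, hz⟩

theorem zero_mem_closure_zariski_line [Infinite K] :
    (0 : K) ∈ @closure K (zariski K K) {0}ᶜ := by
  let _ := zariski K K
  rw [mem_closure_iff]
  intro U hU h0
  have h1 := finite_compl_of_nearAt (isOpen_zariski_iff.1 hU 0 h0)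
  obtain ⟨z, hz⟩ := (h1.union (Set.finite_singleton 0)).infinite_compl.nonempty
  simp only [Set.mem_compl_iff, Set.mem_union, Set.mem_ofPred_eq, not_or, not_not] at hz
  exact ⟨z, hz⟩

end PolynomialCalculus

end LagrangianDual

namespace LagrangianDual

/-! ### Charts and Zariski topology of the Grassmannian -/

section GrassmannianCharts

open Module

variable {K : Type u} [Field K] {n : ℕ} {W : Type v} [AddCommGroup W] [Module K W]

/-- The projection onto the first summand of a splitting. -/
noncomputable def Splitting.prA (D : Splitting K n W) : W →ₗ[K] D.A :=
  Submodule.projectionOnto D.A D.B D.isCompl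

/-- The projection onto the second summand of a splitting. -/
noncomputable def Splitting.prB (D : Splitting K n W) : W →ₗ[K] D.B :=
  Submodule.projectionOnto D.B D.A D.isCompl.symm

theorem Splitting.prA_add_prB (D : Splitting K n W) (w : W) : (D.prA w : W) + D.prB w = w :=
  Submodule.projection_add_projection_eq_self D.isCompl w

@[simp] theorem Splitting.prA_A (D : Splitting K n W) (a : D.A) : D.prA a = a :=
  Submodule.projectionOnto_apply_left D.isCompl a

@[simp] theorem Splitting.prA_B (D : Splitting K n W) (a : D.B) : D.prA a = 0 :=
  Submodule.projectionOnto_apply_right D.isCompl a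

@[simp] theorem Splitting.prB_A (D : Splitting K n W) (a : D.A) : D.prB a = 0 :=
  Submodule.projectionOnto_apply_right D.isCompl.symm a

@[simp] theorem Splitting.prB_B (D : Splitting K n W) (a : D.B) : D.prB a = a :=
  Submodule.projectionOnto_apply_left D.isCompl.symm a

theorem Splitting.graphMap_apply (D : Splitting K n W) (φ : D.A →ₗ[K] D.B) (a : D.A) :
    D.graphMap φ a = (a : W) + φ a := rfl

@[simp] theorem Splitting.prA_graphMap (D : Splitting K n W) (φ : D.A →ₗ[K] D.B) (a : D.A) :
    D.prA (D.graphMap φ a) = a := by simp [graphMap_apply]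

@[simp] theorem Splitting.prB_graphMap (D : Splitting K n W) (φ : D.A →ₗ[K] D.B) (a : D.A) :
    D.prB (D.graphMap φ a) = φ a := by simp [graphMap_apply]

theorem Splitting.mem_graph_iff (D : Splitting K n W) (φ : D.A →ₗ[K] D.B) (w : W) :
    w ∈ (D.graph φ).toSubmodule ↔ D.prB w = φ (D.prA w) := by
  constructor
  · rintro ⟨a, rfl⟩
    simp
  · intro h
    refine ⟨D.prA w, ?_⟩
    rw [graphMap_apply, ← h, prA_add_prB]

theorem Splitting.graphMap_mem (D : Splitting K n W) (φ : D.A →ₗ[K] D.B) (a : D.A) :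
    D.graphMap φ a ∈ (D.graph φ).toSubmodule := ⟨a, rfl⟩

theorem Splitting.graphMap_prA (D : Splitting K n W) (φ : D.A →ₗ[K] D.B) {w : W}
    (hw : w ∈ (D.graph φ).toSubmodule) : D.graphMap φ (D.prA w) = w := by
  rw [graphMap_apply, ← (D.mem_graph_iff φ w).1 hw, prA_add_prB]

theorem Splitting.frame_apply (D : Splitting K n W) (φ : D.A →ₗ[K] D.B) (a : D.A) :
    (D.frame φ a : W) = D.graphMap φ a := rfl

theorem Splitting.coe_frame_symm (D : Splitting K n W) (φ : D.A →ₗ[K] D.B)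
    (w : (D.graph φ).toSubmodule) : (D.frame φ).symm w = D.prA w := by
  rw [LinearEquiv.symm_apply_eq]
  ext
  rw [frame_apply, graphMap_prA _ _ w.2]

theorem Splitting.graph_zero (D : Splitting K n W) : (D.graph 0).toSubmodule = D.A := by
  simp [Splitting.graph, Splitting.graphMap]

section Subspace

variable [FiniteDimensional K W]

theorem Gr.eq_of_le {L M : Gr K n W} (h : L.toSubmodule ≤ M.toSubmodule) : L = M := by
  ext1
  exact Submodule.eq_of_le_of_finrank_eq h (by rw [L.finrank_eq, M.finrank_eq])

theorem Splitting.exists_graph_of_injective (D : Splitting K n W) (L : Gr K n W)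
    (h : Function.Injective (D.prA.domRestrict L.toSubmodule)) : ∃ φ, D.graph φ = L := by
  let f := D.prA.domRestrict L.toSubmodule
  let e : L.toSubmodule ≃ₗ[K] D.A :=
    LinearEquiv.ofInjectiveOfFinrankEq f h (by rw [L.finrank_eq, D.finrank_eq])
  have he : ∀ x, e x = D.prA x := fun _ => rfl
  refine ⟨D.prB ∘ₗ L.toSubmodule.subtype ∘ₗ e.symm.toLinearMap, (Gr.eq_of_le fun x hx => ?_).symm⟩
  rw [mem_graph_iff]
  have : e.symm (D.prA x) = ⟨x, hx⟩ := by rw [LinearEquiv.symm_apply_eq, he]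
  simp [this]

omit [FiniteDimensional K W] in
theorem Splitting.injective_of_graph (D : Splitting K n W) (φ : D.A →ₗ[K] D.B) :
    Function.Injective (D.prA.domRestrict (D.graph φ).toSubmodule) := by
  rintro ⟨x, hx⟩ ⟨y, hy⟩ h
  refine Subtype.ext ((D.graphMap_prA φ hx).symm.trans (Eq.trans ?_ (D.graphMap_prA φ hy)))
  exact congrArg _ h

/-- The subspace spanned by a frame `M : A → W` is the graph of `(pr_B M) (pr_A M)⁻¹`. -/
theorem Splitting.graph_eq_of_range_le (D : Splitting K n W) {M : D.A →ₗ[K] W}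
    (hM : IsUnit (D.prA ∘ₗ M)) {L : Gr K n W} (hL : ∀ a, M a ∈ L.toSubmodule) :
    D.graph ((D.prB ∘ₗ M) ∘ₗ Ring.inverse (D.prA ∘ₗ M)) = L := by
  refine Gr.eq_of_le ?_
  rintro _ ⟨a, rfl⟩
  have h1 : D.prA (M (Ring.inverse (D.prA ∘ₗ M) a)) = a :=
    LinearMap.congr_fun (Ring.mul_inverse_cancel _ hM) a
  have : D.graphMap ((D.prB ∘ₗ M) ∘ₗ Ring.inverse (D.prA ∘ₗ M)) a =
      M (Ring.inverse (D.prA ∘ₗ M) a) := by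
    rw [← D.prA_add_prB (M (Ring.inverse (D.prA ∘ₗ M) a)), h1]
    rfl
  rw [this]
  exact hL _

/-- The kernel of `Θ : W → B` is the graph of `-(Θ|_B)⁻¹ Θ|_A`. -/
theorem Splitting.graph_eq_of_le_ker (D : Splitting K n W) {Θ : W →ₗ[K] D.B}
    (hΘ : IsUnit (Θ ∘ₗ D.B.subtype)) {L : Gr K n W} (hL : ∀ x ∈ L.toSubmodule, Θ x = 0) :
    D.graph (-(Ring.inverse (Θ ∘ₗ D.B.subtype) ∘ₗ (Θ ∘ₗ D.A.subtype))) = L := by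
  refine (Gr.eq_of_le fun x hx => ?_).symm
  rw [mem_graph_iff]
  have h1 : ∀ y, Ring.inverse (Θ ∘ₗ D.B.subtype) (Θ (y : D.B)) = y := fun y =>
    LinearMap.congr_fun (Ring.inverse_mul_cancel _ hΘ) y
  have h2 := hL x hx
  rw [← D.prA_add_prB x, map_add] at h2
  have h3 : Θ (D.prA x) = -Θ (D.prB x) := eq_neg_of_add_eq_zero_left h2
  simp [h3, h1]

/-! ### The Zariski topology of the Grassmannian -/

theorem Gr.isOpen_iff {U : Set (Gr K n W)} : IsOpen U ↔
    ∀ (D : Splitting K n W) (φ : D.A →ₗ[K] D.B), D.graph φ ∈ U →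
      NearAt K (fun ψ => D.graph ψ ∈ U) φ := by
  refine isOpen_iSup_iff.trans (forall_congr' fun D => ?_)
  exact isOpen_coinduced.trans isOpen_zariski_iff

omit [FiniteDimensional K W] in
theorem isPolyMap_graphMap (D : Splitting K n W) : IsPolyMap K D.graphMap :=
  (IsPolyMap.const D.A.subtype).add
    ((IsPolyMap.id).map (LinearMap.llcomp K D.A D.B W D.B.subtype))

/-- Injectivity of a linear map on a subspace is an open condition on the subspace. -/
theorem Gr.isOpen_injective {T : Type*} [AddCommGroup T] [Module K T] (κ : W →ₗ[K] T) :
    IsOpen {L : Gr K n W | Function.Injective (κ.domRestrict L.toSubmodule)} := by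
  have key : ∀ (D : Splitting K n W) (φ : D.A →ₗ[K] D.B),
      Function.Injective (κ.domRestrict (D.graph φ).toSubmodule) ↔
        Function.Injective (κ ∘ₗ D.graphMap φ) := by
    intro D φ
    rw [← (D.frame φ).injective_comp]
    rfl
  rw [Gr.isOpen_iff]
  intro D φ hφ
  have h1 : IsPolyMap K fun φ => κ ∘ₗ D.graphMap φ :=
    (isPolyMap_graphMap D).map (LinearMap.llcomp K D.A W T κ)
  exact (NearAt.injective h1 ((key D φ).1 hφ)).mono fun ψ hψ => (key D ψ).2 hψ

/-- The cell of a chart is open. -/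
theorem Splitting.isOpen_range_graph (D : Splitting K n W) : IsOpen (Set.range D.graph) := by
  convert Gr.isOpen_injective (n := n) D.prA using 1
  ext L
  exact ⟨by rintro ⟨φ, rfl⟩; exact D.injective_of_graph φ, D.exists_graph_of_injective L⟩

/-- The image of a subspace under a linear map has large dimension on an open set. -/
theorem Gr.isOpen_le_finrank_map {T : Type*} [AddCommGroup T] [Module K T] (κ : W →ₗ[K] T)
    (k : ℕ) : IsOpen {L : Gr K n W | k ≤ finrank K (L.toSubmodule.map κ)} := by
  rw [Gr.isOpen_iff]
  intro D φ (hφ : k ≤ _)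
  have hr : ∀ φ, (D.graph φ).toSubmodule.map κ = LinearMap.range (κ ∘ₗ D.graphMap φ) :=
    fun φ => (LinearMap.range_comp _ _).symm
  -- The section σ embeds the image at φ into A. For nearby ψ the composite with σ stays injective,
  -- so the image at ψ is at least as large.
  obtain ⟨σ, hσ⟩ := (κ ∘ₗ D.graphMap φ).rangeRestrict.exists_rightInverse_of_surjective
    (LinearMap.range_rangeRestrict _)
  have h1 : IsPolyMap K fun ψ => (κ ∘ₗ D.graphMap ψ) ∘ₗ σ :=
    ((isPolyMap_graphMap D).map (LinearMap.llcomp K D.A W T κ)).llcomp (.const σ)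
  have h2 : (κ ∘ₗ D.graphMap φ) ∘ₗ σ = Submodule.subtype _ := by
    ext x
    exact congrArg Subtype.val (LinearMap.congr_fun hσ x)
  refine (NearAt.injective h1 (z₀ := φ) (by rw [h2]; exact Subtype.val_injective)).mono
    fun ψ hψ => ?_
  rw [hr] at hφ
  refine hφ.trans ?_
  rw [← LinearMap.finrank_range_of_inj hψ, hr]
  exact Submodule.finrank_mono (LinearMap.range_comp_le_range _ _)

/-- The chart may depend on the point `z₀`: an open set is a principal neighborhood condition in
each chart, and such conditions pull back along rational maps. -/
theorem continuous_of_rational {E : Type*} [AddCommGroup E] [Module K E] {γ : E → Gr K n W}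
    (h : ∀ z₀, ∃ (D : Splitting K n W) (f : E → D.A →ₗ[K] D.B), RationalAt K f z₀ ∧
      NearAt K (fun z => γ z = D.graph (f z)) z₀) : @Continuous _ _ (zariski K E) _ γ := by
  let _ := zariski K E
  refine ⟨fun U hU => isOpen_zariski_iff.2 fun z₀ hz₀ => ?_⟩
  obtain ⟨D, f, hf, hγ⟩ := h z₀
  have h1 : D.graph (f z₀) ∈ U := hγ.self ▸ hz₀
  refine (hγ.and ((Gr.isOpen_iff.1 hU D (f z₀) h1).comp_rational hf)).mono fun z hz => ?_
  rw [Set.mem_preimage, hz.1]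
  exact hz.2

/-- The images of a fixed subspace under a polynomial family of maps, injective on it, form a
continuous family. -/
theorem continuous_map_of_isPolyMap {E : Type*} [AddCommGroup E] [Module K E] (L : Gr K n W)
    {M : E → W →ₗ[K] W} (hM : IsPolyMap K M) {γ : E → Gr K n W}
    (hγ : ∀ z, (γ z).toSubmodule = L.toSubmodule.map (M z)) :
    @Continuous _ _ (zariski K E) _ γ := by
  refine continuous_of_rational fun z₀ => ?_
  -- The chart is centered at `γ z₀`. The frame N is `M z` on L, reparametrized by an arbitrary
  -- isomorphism of `D.A` with L. At `z₀` it maps onto `D.A`, so its first component is invertible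
  -- there and hence nearby.
  obtain ⟨B, hB⟩ := Submodule.exists_isCompl (γ z₀).toSubmodule
  let D : Splitting K n W := ⟨(γ z₀).toSubmodule, B, hB, (γ z₀).finrank_eq⟩
  let e : D.A ≃ₗ[K] L.toSubmodule :=
    LinearEquiv.ofFinrankEq _ _ (by rw [L.finrank_eq, D.finrank_eq])
  let N : E → D.A →ₗ[K] W := fun z => M z ∘ₗ L.toSubmodule.subtype ∘ₗ e.toLinearMap
  have hN : IsPolyMap K N := hM.llcomp (.const (L.toSubmodule.subtype ∘ₗ e.toLinearMap))
  have hNγ : ∀ z a, N z a ∈ (γ z).toSubmodule := fun z a => by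
    rw [hγ]
    exact ⟨e a, (e a).2, rfl⟩
  have h1 : IsPolyMap K fun z => D.prA ∘ₗ N z := (IsPolyMap.const _).llcomp hN
  have h2 : IsUnit (D.prA ∘ₗ N z₀) := by
    refine (Module.End.isUnit_iff _).2 ?_
    have : Function.Surjective (D.prA ∘ₗ N z₀) := by
      intro a
      have ha : (a : W) ∈ L.toSubmodule.map (M z₀) := hγ z₀ ▸ a.2
      obtain ⟨x, hx, hxa⟩ := ha
      refine ⟨e.symm ⟨x, hx⟩, ?_⟩
      simp [N, hxa]
    exact ⟨LinearMap.injective_iff_surjective.2 this, this⟩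
  refine ⟨D, fun z => (D.prB ∘ₗ N z) ∘ₗ Ring.inverse (D.prA ∘ₗ N z), ?_, ?_⟩
  · exact (((IsPolyMap.const _).llcomp hN).rationalAt z₀).llcomp (RationalAt.ringInverse h1 h2)
  · exact (NearAt.isUnit h1 h2).mono fun z hz => (D.graph_eq_of_range_le hz (hNγ z)).symm

end Subspace

end GrassmannianCharts

end LagrangianDual

namespace LagrangianDual

open Module

/-! ### Alternating bilinear forms -/

section AlternatingForms

variable {K : Type u} [Field K] {A : Type*} [AddCommGroup A] [Module K A]

/-- The alternating part `(x, y) ↦ (β x y - β y x) / 2` of a bilinear form. -/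
noncomputable def skewPart : (A →ₗ[K] A →ₗ[K] K) →ₗ[K] (A [⋀^Fin 2]→ₗ[K] K) where
  toFun β :=
    { toFun := fun v => 2⁻¹ * (β (v 0) (v 1) - β (v 1) (v 0))
      map_update_add' := by
        intro _ m i x y
        obtain rfl : ‹DecidableEq (Fin 2)› = instDecidableEqFin 2 := Subsingleton.elim _ _
        fin_cases i <;> simp [Function.update] <;> ring
      map_update_smul' := by
        intro _ m i c x
        obtain rfl : ‹DecidableEq (Fin 2)› = instDecidableEqFin 2 := Subsingleton.elim _ _
        fin_cases i <;> simp [Function.update] <;> ring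
      map_eq_zero_of_eq' := by
        intro v i j h hij
        have : v 0 = v 1 := by
          fin_cases i <;> fin_cases j <;> simp_all
        simp [this] }
  map_add' β γ := by
    ext v
    simp only [AlternatingMap.add_apply, AlternatingMap.coe_mk, MultilinearMap.coe_mk,
      LinearMap.add_apply]
    ring
  map_smul' c β := by
    ext v
    simp only [AlternatingMap.smul_apply, AlternatingMap.coe_mk, MultilinearMap.coe_mk,
      LinearMap.smul_apply, smul_eq_mul, RingHom.id_apply]
    ring

theorem skewPart_apply (β : A →ₗ[K] A →ₗ[K] K) (x y : A) :
    skewPart β ![x, y] = 2⁻¹ * (β x y - β y x) := rfl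

theorem update_pair_one {α : Type*} (x y z : α) :
    Function.update ![x, y] 1 z = ![x, z] := by
  ext i
  fin_cases i <;> rfl

/-- The bilinear form underlying an alternating form. -/
def altBilin (ω : A [⋀^Fin 2]→ₗ[K] K) : A →ₗ[K] A →ₗ[K] K :=
  LinearMap.mk₂ K (fun x y => ω ![x, y])
    (fun x x' y => ω.map_vecCons_add ![y] x x')
    (fun c x y => ω.map_vecCons_smul ![y] c x)
    (fun x y y' => by
      have h := ω.map_update_add ![x, y] 1 y y'
      simpa only [update_pair_one] using h)
    (fun c x y => by
      have h := ω.map_update_smul ![x, y] 1 c y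
      simpa only [update_pair_one] using h)

theorem altBilin_apply (ω : A [⋀^Fin 2]→ₗ[K] K) (x y : A) : altBilin ω x y = ω ![x, y] := rfl

theorem alt_self (ω : A [⋀^Fin 2]→ₗ[K] K) (x : A) : ω ![x, x] = 0 :=
  ω.map_eq_zero_of_eq _ (i := 0) (j := 1) rfl (by simp)

theorem alt_ext {ω η : A [⋀^Fin 2]→ₗ[K] K} (h : ∀ x y, ω ![x, y] = η ![x, y]) : ω = η := by
  ext v
  have : v = ![v 0, v 1] := by ext i; fin_cases i <;> rfl
  rw [this]
  exact h _ _

theorem isPolyMap_alt_apply {E : Type*} [AddCommGroup E] [Module K E]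
    {f : E → A [⋀^Fin 2]→ₗ[K] K} (hf : IsPolyMap K f) (x y : A) :
    IsPolyMap K (fun z => f z ![x, y]) :=
  hf.map { toFun := fun ω => ω ![x, y], map_add' := fun _ _ => rfl, map_smul' := fun _ _ => rfl }

/-- A nondegenerate alternating form lives in even dimension. -/
theorem even_finrank_of_alternating (hK : ringChar K ≠ 2) [FiniteDimensional K A]
    (β : LinearMap.BilinForm K A) (halt : ∀ x, β x x = 0)
    (hnd : ∀ x, (∀ y, β x y = 0) → x = 0) : Even (finrank K A) := by
  by_contra hodd
  rw [Nat.not_even_iff_odd] at hodd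
  let e := Module.finBasis K A
  have hsk : ∀ x y, β x y = -β y x := fun x y => by
    have := halt (x + y)
    simp only [map_add, LinearMap.add_apply, halt] at this
    linear_combination this
  have h1 : (LinearMap.BilinForm.toMatrix e β).transpose = -LinearMap.BilinForm.toMatrix e β := by
    ext i j
    simp [LinearMap.BilinForm.toMatrix_apply, hsk (e j) (e i)]
  have h2 := congrArg Matrix.det h1
  -- In odd dimension d a skew matrix satisfies det = (-1)^d det = -det, so its determinant vanishes
  -- because 2 is invertible.
  rw [Matrix.det_transpose, Matrix.det_neg, Fintype.card_fin, hodd.neg_one_pow] at h2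
  have h3 : (2 : K) * (LinearMap.BilinForm.toMatrix e β).det = 0 := by linear_combination h2
  have h4 := (mul_eq_zero.1 h3).resolve_left (Ring.two_ne_zero hK)
  refine (LinearMap.BilinForm.nondegenerate_iff_det_ne_zero e).1 ?_ h4
  have : β.SeparatingLeft := hnd
  exact ⟨this, fun y hy => hnd y fun x => by rw [hsk, hy, neg_zero]⟩

end AlternatingForms

/-! ### Lagrangian subspaces as pairs (F, ω), and the parity of dim F -/

section Extensions

variable {K : Type u} [Field K] {V : Type v} [AddCommGroup V] [Module K V]
variable {b : LinearMap.BilinForm K V}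

/-- The image of `L ⊆ V ⊕ εV` in `V`. -/
abbrev baseOf (L : Submodule K (V × V)) : Submodule K V := L.map (LinearMap.fst K V V)

theorem mem_baseOf {L : Submodule K (V × V)} {a : V} : a ∈ baseOf L ↔ ∃ c, (a, c) ∈ L := by
  constructor
  · rintro ⟨⟨a, c⟩, h, rfl⟩
    exact ⟨c, h⟩
  · rintro ⟨c, h⟩
    exact ⟨_, h, rfl⟩

theorem q₂_snd (x : V × V) : (q₂ b x).snd = b x.1 x.2 + b x.2 x.1 := by
  simp [q₂, b₂]

theorem OGrEps_polar (hsymm : b.IsSymm) {L : Gr K (finrank K V) (V × V)} (hL : L ∈ OGrEps b)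
    (hK : ringChar K ≠ 2) {x y : V × V} (hx : x ∈ L.toSubmodule) (hy : y ∈ L.toSubmodule) :
    b x.1 y.2 + b x.2 y.1 = 0 := by
  have h1 := hL _ hx
  have h2 := hL _ hy
  have h3 := hL _ (L.toSubmodule.add_mem hx hy)
  rw [q₂_snd] at h1 h2 h3
  simp only [Prod.fst_add, Prod.snd_add, map_add, LinearMap.add_apply] at h3
  have e1 := hsymm.eq x.1 y.2
  have e2 := hsymm.eq y.1 x.2
  have : (2 : K) * (b x.1 y.2 + b x.2 y.1) = 0 := by
    linear_combination h3 - h1 - h2 + e1 - e2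
  exact (mul_eq_zero.1 this).resolve_left (Ring.two_ne_zero hK)

theorem mem_extensionOf {i : ℕ} {F : Gr K i V} {ω : Alt2 F} {x : V × V} :
    x ∈ extensionOf b F ω ↔
      ∃ h : x.1 ∈ F.toSubmodule, ∀ f : F.toSubmodule, b x.2 f = ω ![⟨x.1, h⟩, f] := Iff.rfl

theorem zero_mem_extensionOf_iff {i : ℕ} {F : Gr K i V} {ω : Alt2 F} {c : V} :
    (0, c) ∈ extensionOf b F ω ↔ ∀ f ∈ F.toSubmodule, b c f = 0 := by
  have h0 : ∀ f : F.toSubmodule, ω ![0, f] = 0 := fun f => ω.map_coord_zero 0 (by simp)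
  rw [mem_extensionOf]
  constructor
  · rintro ⟨h, h'⟩ f hf
    exact (h' ⟨f, hf⟩).trans (h0 _)
  · intro h
    exact ⟨F.toSubmodule.zero_mem, fun f => (h f f.2).trans (h0 _).symm⟩

variable [FiniteDimensional K V]

theorem exists_represent (hnd : b.Nondegenerate) (F : Submodule K V) (l : F →ₗ[K] K) :
    ∃ c : V, ∀ f : F, b c f = l f := by
  obtain ⟨l', hl'⟩ := l.exists_extend
  obtain ⟨c, hc⟩ := (b.toDual hnd).surjective l'
  refine ⟨c, fun f => ?_⟩
  have h1 : b c f = l' f := by rw [← hc, LinearMap.BilinForm.toDual_def]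
  rw [h1, ← hl']
  rfl

theorem baseOf_extensionOf (hnd : b.Nondegenerate) {i : ℕ} (F : Gr K i V) (ω : Alt2 F) :
    baseOf (extensionOf b F ω) = F.toSubmodule := by
  ext a
  rw [mem_baseOf]
  constructor
  · rintro ⟨c, h, -⟩
    exact h
  · intro ha
    obtain ⟨c, hc⟩ := exists_represent hnd F.toSubmodule (altBilin ω ⟨a, ha⟩)
    exact ⟨c, ha, hc⟩

/-- The subspace is the kernel of (a, c) ↦ b(c, ·) - ω(a, ·) from F × V to F*. Nondegeneracy makes
the V-component alone surjective, so the dimension is dim F + dim V - dim F. -/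
theorem finrank_extensionOf (hnd : b.Nondegenerate) {i : ℕ} (F : Gr K i V) (ω : Alt2 F) :
    finrank K (extensionOf b F ω) = finrank K V := by
  let h : F.toSubmodule × V →ₗ[K] (F.toSubmodule →ₗ[K] K) :=
    (LinearMap.lcomp K K F.toSubmodule.subtype ∘ₗ b) ∘ₗ LinearMap.snd K _ _ -
      altBilin ω ∘ₗ LinearMap.fst K _ _
  have hsurj : LinearMap.range h = ⊤ := by
    rw [LinearMap.range_eq_top]
    intro l
    obtain ⟨c, hc⟩ := exists_represent hnd F.toSubmodule l
    refine ⟨(0, c), ?_⟩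
    ext f
    simp [h, hc]
  have h1 := h.finrank_range_add_finrank_ker
  rw [hsurj, finrank_top, Module.finrank_prod, Subspace.dual_finrank_eq] at h1
  have h2 : extensionOf b F ω = (LinearMap.ker h).map
      (LinearMap.prodMap F.toSubmodule.subtype LinearMap.id) := by
    ext ⟨a, c⟩
    rw [mem_extensionOf]
    constructor
    · rintro ⟨ha, hc⟩
      refine ⟨(⟨a, ha⟩, c), ?_, rfl⟩
      rw [SetLike.mem_coe, LinearMap.mem_ker]
      ext f
      simpa [h, sub_eq_zero, altBilin_apply] using hc f
    · rintro ⟨⟨a', c'⟩, hk, he⟩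
      obtain ⟨rfl, rfl⟩ := Prod.mk.inj he
      refine ⟨a'.2, fun f => ?_⟩
      have := LinearMap.congr_fun (LinearMap.mem_ker.1 hk) f
      simpa [h, sub_eq_zero, altBilin_apply] using this
  have h3 : Function.Injective (LinearMap.prodMap F.toSubmodule.subtype
      (LinearMap.id : V →ₗ[K] V)) := Subtype.val_injective.prodMap Function.injective_id
  have h4 := (Submodule.equivMapOfInjective _ h3 (LinearMap.ker h)).finrank_eq
  rw [h2]
  omega

/-- The Lagrangian subspace attached to `F` and `ω`, as a point of the Grassmannian. -/
def extGr (hnd : b.Nondegenerate) {i : ℕ} (F : Gr K i V) (ω : Alt2 F) :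
    Gr K (finrank K V) (V × V) :=
  ⟨extensionOf b F ω, finrank_extensionOf hnd F ω⟩

theorem extGr_mem_OGrEps (hnd : b.Nondegenerate) (hsymm : b.IsSymm) {i : ℕ} (F : Gr K i V)
    (ω : Alt2 F) : extGr hnd F ω ∈ OGrEps b := by
  rintro x ⟨h, h'⟩
  rw [q₂_snd, hsymm.eq x.1 x.2, h' ⟨x.1, h⟩, alt_self, add_zero]

theorem extGr_ext (hnd : b.Nondegenerate) {i : ℕ} {F : Gr K i V} {ω η : Alt2 F}
    (h : extensionOf b F ω = extensionOf b F η) : ω = η := by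
  refine alt_ext fun x y => ?_
  obtain ⟨c, hc⟩ := exists_represent hnd F.toSubmodule (altBilin ω x)
  have h1 : ((x : V), c) ∈ extensionOf b F ω := ⟨x.2, hc⟩
  rw [h] at h1
  obtain ⟨_, h2⟩ := h1
  exact (hc y).symm.trans (h2 y)

/-- For (a, c) in L, the functional b(c, ·) on F depends only on a, and polarizing the ε-coefficient
of `q₂` shows that the resulting form on F is skew. It is computed through a linear section σ of L →
F. Isotropy of F plays no role, so the description covers all of `OGrEps`. Both subspaces have
dimension dim V, hence one inclusion suffices. -/
theorem exists_eq_extGr (hK : ringChar K ≠ 2) (hnd : b.Nondegenerate) (hsymm : b.IsSymm)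
    {L : Gr K (finrank K V) (V × V)} (hL : L ∈ OGrEps b) {i : ℕ} (F : Gr K i V)
    (hF : F.toSubmodule = baseOf L.toSubmodule) : ∃ ω : Alt2 F, L = extGr hnd F ω := by
  obtain ⟨F, hi⟩ := F
  dsimp only at hF
  subst hF
  let p : L.toSubmodule →ₗ[K] baseOf L.toSubmodule :=
    (LinearMap.fst K V V).submoduleMap L.toSubmodule
  obtain ⟨σ, hσ⟩ := p.exists_rightInverse_of_surjective
    (LinearMap.range_eq_top.2 ((LinearMap.fst K V V).submoduleMap_surjective _))
  have hσ1 : ∀ a, (σ a : V × V).1 = a := fun a =>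
    congrArg Subtype.val (LinearMap.congr_fun hσ a)
  let β : baseOf L.toSubmodule →ₗ[K] baseOf L.toSubmodule →ₗ[K] K :=
    b.compl₁₂ (LinearMap.snd K V V ∘ₗ L.toSubmodule.subtype ∘ₗ σ) (Submodule.subtype _)
  have hβ : ∀ x y, β x y = b (σ x : V × V).2 y := fun _ _ => rfl
  have h1 : ∀ x ∈ L.toSubmodule, ∀ f : baseOf L.toSubmodule,
      b x.2 f = -b (σ f : V × V).2 x.1 := fun x hx f => by
    have := OGrEps_polar hsymm hL hK hx (σ f).2
    rw [hσ1, hsymm.eq x.1] at this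
    linear_combination this
  -- By polarization β is already skew; taking its alternating part only repackages it as an
  -- `AlternatingMap`.
  refine ⟨skewPart β, Gr.eq_of_le fun x hx => ⟨⟨x, hx, rfl⟩, fun f => ?_⟩⟩
  have h2 := h1 _ (σ ⟨x.1, ⟨x, hx, rfl⟩⟩).2 f
  have h2K : (2 : K) ≠ 0 := Ring.two_ne_zero hK
  rw [hσ1] at h2
  rw [skewPart_apply, hβ, hβ, h2, h1 x hx f]
  field_simp
  ring

/-- Stability under ε says (0, a) ∈ L for every a ∈ F, and the vertical vectors of L are those of
F^⊥. So the condition is F ⊆ F^⊥. -/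
theorem mem_OSigma_iff_baseOf (hK : ringChar K ≠ 2) (hnd : b.Nondegenerate) (hsymm : b.IsSymm)
    {L : Gr K (finrank K V) (V × V)} (hL : L ∈ OGrEps b) :
    L ∈ OSigma b ↔ ∀ x ∈ baseOf L.toSubmodule, ∀ y ∈ baseOf L.toSubmodule, b x y = 0 := by
  constructor
  · rintro ⟨-, h⟩ x ⟨x', hx', rfl⟩ y ⟨y', hy', rfl⟩
    have := OGrEps_polar hsymm hL hK (h ⟨x', hx', rfl⟩) hy'
    simpa [eps] using this
  · intro h
    refine ⟨hL, ?_⟩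
    rintro _ ⟨x, hx, rfl⟩
    obtain ⟨ω, hω⟩ := exists_eq_extGr hK hnd hsymm hL ⟨baseOf L.toSubmodule, rfl⟩ rfl
    have hx1 : x.1 ∈ baseOf L.toSubmodule := ⟨x, hx, rfl⟩
    rw [hω]
    exact zero_mem_extensionOf_iff.2 fun f hf => h _ hx1 _ hf

omit [FiniteDimensional K V] in
theorem OGr_polar (hK : ringChar K ≠ 2) (hsymm : b.IsSymm) {F : Submodule K V}
    (h : ∀ x ∈ F, b x x = 0) : ∀ x ∈ F, ∀ y ∈ F, b x y = 0 := by
  intro x hx y hy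
  have h1 := h _ (F.add_mem hx hy)
  simp only [map_add, LinearMap.add_apply, h x hx, h y hy, hsymm.eq y x] at h1
  have : (2 : K) * b x y = 0 := by linear_combination h1
  exact (mul_eq_zero.1 this).resolve_left (Ring.two_ne_zero hK)

theorem extGr_mem_OSigmaStratum (hK : ringChar K ≠ 2) (hnd : b.Nondegenerate) (hsymm : b.IsSymm)
    {i : ℕ} {F : Gr K i V} (hF : F ∈ OGr b i) (ω : Alt2 F) :
    extGr hnd F ω ∈ OSigmaStratum b i := by
  have h : baseOf (extGr hnd F ω).toSubmodule = F.toSubmodule := baseOf_extensionOf hnd F ω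
  refine ⟨(mem_OSigma_iff_baseOf hK hnd hsymm (extGr_mem_OGrEps hnd hsymm F ω)).2 ?_, ?_⟩
  · rw [h]
    exact OGr_polar hK hsymm hF
  · exact (congrArg (fun S : Submodule K V => finrank K S) h).trans F.finrank_eq

theorem zero_mem_iff (hK : ringChar K ≠ 2) (hnd : b.Nondegenerate) (hsymm : b.IsSymm)
    {L : Gr K (finrank K V) (V × V)} (hL : L ∈ OGrEps b) (c : V) :
    (0, c) ∈ L.toSubmodule ↔ ∀ f ∈ baseOf L.toSubmodule, b c f = 0 := by
  obtain ⟨ω, hω⟩ := exists_eq_extGr hK hnd hsymm hL ⟨baseOf L.toSubmodule, rfl⟩ rfl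
  conv_lhs => rw [hω]
  exact zero_mem_extensionOf_iff

/-! ### Local constancy of the parity of `dim π(L)` -/

omit [FiniteDimensional K V] in
theorem orthogonal_sup (F G : Submodule K V) :
    b.orthogonal (F ⊔ G) = b.orthogonal F ⊓ b.orthogonal G := by
  refine le_antisymm (le_inf (LinearMap.BilinForm.orthogonal_le le_sup_left)
    (LinearMap.BilinForm.orthogonal_le le_sup_right)) ?_
  rintro x ⟨hx, hx'⟩ y hy
  obtain ⟨f, hf, g, hg, rfl⟩ := Submodule.mem_sup.1 hy
  have h1 : b f x = 0 := hx f hf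
  have h2 : b g x = 0 := hx' g hg
  change b (f + g) x = 0
  rw [map_add, LinearMap.add_apply, h1, h2, add_zero]

theorem finrank_add_finrank_orthogonal_eq (hnd : b.Nondegenerate) (F : Submodule K V) :
    finrank K F + finrank K (b.orthogonal F) = finrank K V := by
  rw [LinearMap.BilinForm.finrank_orthogonal hnd]
  have := F.finrank_le
  omega

/-- The hypothesis is transversality to the Lagrangian G^⊥ ⊕ εG. It forces F^⊥ ∩ G = 0, hence dim F
= dim G + dim (F ∩ G^⊥). It also makes ω nondegenerate on F ∩ G^⊥, so that this space has even
dimension. -/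
theorem even_finrank_baseOf_add (hK : ringChar K ≠ 2) (hnd : b.Nondegenerate) (hsymm : b.IsSymm)
    {L : Gr K (finrank K V) (V × V)} (hL : L ∈ OGrEps b) (G : Submodule K V)
    (hG : Disjoint L.toSubmodule ((b.orthogonal G).prod G)) :
    Even (finrank K (baseOf L.toSubmodule) + finrank K G) := by
  set F := baseOf L.toSubmodule with hF
  have hrefl : b.IsRefl := hsymm.isRefl
  have hdisj := Submodule.disjoint_def.1 hG
  have h0 := zero_mem_iff hK hnd hsymm hL
  obtain ⟨ω, hω⟩ := exists_eq_extGr hK hnd hsymm hL ⟨F, rfl⟩ rfl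
  have hH : b.orthogonal (b.orthogonal F ⊔ G) = F ⊓ b.orthogonal G := by
    rw [orthogonal_sup, LinearMap.BilinForm.orthogonal_orthogonal hnd hrefl]
  have hFG : b.orthogonal F ⊓ G = ⊥ := by
    rw [eq_bot_iff]
    rintro g ⟨hg, hg'⟩
    have h1 : (0, g) ∈ L.toSubmodule := (h0 g).2 fun f hf => (hsymm.eq _ _).trans (hg f hf)
    exact (Prod.mk.inj (hdisj _ h1 ⟨Submodule.zero_mem _, hg'⟩)).2
  have hdim : finrank K F = finrank K G + finrank K (F ⊓ b.orthogonal G : Submodule K V) := by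
    have e1 := finrank_add_finrank_orthogonal_eq hnd F
    have e2 := finrank_add_finrank_orthogonal_eq hnd (b.orthogonal F ⊔ G)
    have e3 := Submodule.finrank_sup_add_finrank_inf_eq (b.orthogonal F) G
    rw [hFG, finrank_bot] at e3
    rw [hH] at e2
    omega
  have heven : Even (finrank K (F ⊓ b.orthogonal G : Submodule K V)) := by
    let ι : (F ⊓ b.orthogonal G : Submodule K V) →ₗ[K] F := Submodule.inclusion inf_le_left
    refine even_finrank_of_alternating hK ((altBilin ω).compl₁₂ ι ι)
      (fun x => alt_self ω _) fun x hx => ?_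
    obtain ⟨c, hc⟩ := mem_baseOf.1 x.2.1
    have hc' := hc
    rw [hω] at hc'
    obtain ⟨_, hc2⟩ := hc'
    -- If x is in the radical of ω on F ∩ G^⊥ and (x, c) ∈ L, then c ∈ (F ∩ G^⊥)^⊥ = F^⊥ + G.
    -- Subtracting the F^⊥-part, which is vertical in L, leaves a vector (x, g) in L ∩ (G^⊥ ⊕ εG) =
    -- 0.
    have h1 : c ∈ b.orthogonal F ⊔ G := by
      rw [← LinearMap.BilinForm.orthogonal_orthogonal hnd hrefl (b.orthogonal F ⊔ G), hH]
      intro y hy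
      exact (hsymm.eq _ _).trans ((hc2 (ι ⟨y, hy⟩)).trans (hx ⟨y, hy⟩))
    obtain ⟨c', hc', g, hg, rfl⟩ := Submodule.mem_sup.1 h1
    have h2 : (0, c') ∈ L.toSubmodule := (h0 c').2 fun f hf => (hsymm.eq _ _).trans (hc' f hf)
    have h3 : ((x : V), g) ∈ L.toSubmodule := by
      have := L.toSubmodule.sub_mem hc h2
      simpa using this
    exact Subtype.ext (Prod.mk.inj (hdisj _ h3 ⟨x.2.2, hg⟩)).1
  rw [hdim]
  obtain ⟨k, hk⟩ := heven
  exact ⟨finrank K G + k, by omega⟩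

/-- For G a complement of F^⊥, the subspace `L₀` is transversal to G^⊥ ⊕ εG. Transversality means
injectivity of the quotient map on L, an open condition, and throughout this open set dim π(L) has
the parity of dim G. -/
theorem exists_open_parity (hK : ringChar K ≠ 2) (hnd : b.Nondegenerate) (hsymm : b.IsSymm)
    {L₀ : Gr K (finrank K V) (V × V)} (hL₀ : L₀ ∈ OGrEps b) :
    ∃ U : Set (Gr K (finrank K V) (V × V)), IsOpen U ∧ L₀ ∈ U ∧ ∀ L ∈ U, L ∈ OGrEps b →
      finrank K (baseOf L.toSubmodule) % 2 = finrank K (baseOf L₀.toSubmodule) % 2 := by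
  set F := baseOf L₀.toSubmodule with hF
  have hrefl : b.IsRefl := hsymm.isRefl
  obtain ⟨G, hG⟩ := Submodule.exists_isCompl (b.orthogonal F)
  have key : ∀ L : Gr K (finrank K V) (V × V),
      Function.Injective (((b.orthogonal G).prod G).mkQ.domRestrict L.toSubmodule) ↔
        Disjoint L.toSubmodule ((b.orthogonal G).prod G) := by
    intro L
    rw [← LinearMap.ker_eq_bot, LinearMap.ker_domRestrict, Submodule.ker_mkQ,
      ← Submodule.disjoint_iff_comap_eq_bot]
  have h₀ : Disjoint L₀.toSubmodule ((b.orthogonal G).prod G) := by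
    rw [Submodule.disjoint_def]
    rintro ⟨a, c⟩ hx ⟨ha, hc⟩
    have ha' : a ∈ F := ⟨_, hx, rfl⟩
    have h1 : a ∈ b.orthogonal (b.orthogonal F ⊔ G) := by
      rw [orthogonal_sup, LinearMap.BilinForm.orthogonal_orthogonal hnd hrefl]
      exact ⟨ha', ha⟩
    rw [hG.sup_eq_top, LinearMap.BilinForm.orthogonal_top_eq_bot hnd] at h1
    obtain rfl : a = 0 := h1
    have h2 : c ∈ b.orthogonal F := fun f hf =>
      (hsymm.eq _ _).trans ((zero_mem_iff hK hnd hsymm hL₀ c).1 hx f hf)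
    rw [Submodule.disjoint_def.1 hG.disjoint c h2 hc]
    rfl
  refine ⟨_, Gr.isOpen_injective ((b.orthogonal G).prod G).mkQ, (key L₀).2 h₀, fun L hL hL' => ?_⟩
  have e1 := even_finrank_baseOf_add hK hnd hsymm hL' G ((key L).1 hL)
  have e2 := even_finrank_baseOf_add hK hnd hsymm hL₀ G h₀
  rw [← hF] at e2
  rw [Nat.even_iff] at e1 e2
  omega

/-! ### Closed conditions -/

theorem Gr.isClosed_isotropic {W : Type*} [AddCommGroup W] [Module K W] [FiniteDimensional K W]
    {n : ℕ} (β : W →ₗ[K] W →ₗ[K] K) :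
    IsClosed {L : Gr K n W | ∀ x ∈ L.toSubmodule, β x x = 0} := by
  rw [← isOpen_compl_iff, Gr.isOpen_iff]
  intro D φ hφ
  have hφ' : ∃ x ∈ (D.graph φ).toSubmodule, β x x ≠ 0 := by
    simpa only [Set.mem_compl_iff, Set.mem_ofPred_eq, not_forall, exists_prop] using hφ
  obtain ⟨_, ⟨a, rfl⟩, ha⟩ := hφ'
  have h1 : IsPolyMap K fun ψ => D.graphMap ψ a := (isPolyMap_graphMap D).apply a
  exact ⟨fun ψ => β (D.graphMap ψ a) (D.graphMap ψ a), isPolyMap_iff_mem.1 (.map₂ β h1 h1), ha,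
    fun ψ hψ h => hψ (h _ ⟨a, rfl⟩)⟩

theorem isClosed_OGrEps : IsClosed (OGrEps b) := by
  convert Gr.isClosed_isotropic (n := finrank K V) (W := V × V)
    (b.compl₁₂ (LinearMap.fst K V V) (LinearMap.snd K V V) +
      b.compl₁₂ (LinearMap.snd K V V) (LinearMap.fst K V V)) using 1
  ext L
  refine forall₂_congr fun x _ => ?_
  rw [q₂_snd]
  rfl

/-- Inside `OGrEps`, membership in OΣ is isotropy of π(L), which is the vanishing on L of the form
b(a, a). -/
theorem isClosed_OSigma (hK : ringChar K ≠ 2) (hnd : b.Nondegenerate) (hsymm : b.IsSymm) :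
    IsClosed (OSigma b) := by
  convert (isClosed_OGrEps (b := b)).inter (Gr.isClosed_isotropic (n := finrank K V) (W := V × V)
    (b.compl₁₂ (LinearMap.fst K V V) (LinearMap.fst K V V))) using 1
  ext L
  constructor
  · intro h
    refine ⟨h.1, fun x hx => ?_⟩
    have hx1 : x.1 ∈ baseOf L.toSubmodule := ⟨x, hx, rfl⟩
    exact (mem_OSigma_iff_baseOf hK hnd hsymm h.1).1 h _ hx1 _ hx1
  · rintro ⟨h, h'⟩
    refine (mem_OSigma_iff_baseOf hK hnd hsymm h).2 (OGr_polar hK hsymm ?_)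
    rintro _ ⟨x, hx, rfl⟩
    exact h' x hx

end Extensions

end LagrangianDual

namespace LagrangianDual

open Module

/-! ### Rationality of (F, ω) ↦ L and of its inverse in charts -/

section ChartRegularity

variable {K : Type u} [Field K] {V : Type v} [AddCommGroup V] [Module K V]
variable [FiniteDimensional K V] {b : LinearMap.BilinForm K V}

/-- The Lagrangian subspace with given coordinates in a chart of the bundle `Λ²S*`. -/
noncomputable def extChart (hnd : b.Nondegenerate) {i : ℕ} (D : Splitting K i V)
    (z : (D.A →ₗ[K] D.B) × (D.A [⋀^Fin 2]→ₗ[K] K)) : Gr K (finrank K V) (V × V) :=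
  extGr hnd (D.graph z.1) (z.2.compLinearMap (D.frame z.1).symm.toLinearMap)

theorem mem_extChart (hnd : b.Nondegenerate) {i : ℕ} (D : Splitting K i V)
    (z : (D.A →ₗ[K] D.B) × (D.A [⋀^Fin 2]→ₗ[K] K)) (x : V × V) :
    x ∈ (extChart hnd D z).toSubmodule ↔ D.prB x.1 = z.1 (D.prA x.1) ∧
      ∀ a, b x.2 (D.graphMap z.1 a) = z.2 ![D.prA x.1, a] := by
  have e : ∀ s t : (D.graph z.1).toSubmodule,
      z.2.compLinearMap (D.frame z.1).symm.toLinearMap ![s, t] = z.2 ![D.prA s, D.prA t] := by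
    intro s t
    rw [AlternatingMap.compLinearMap_apply]
    congr 1
    ext i
    fin_cases i
    · exact congrArg _ (D.coe_frame_symm z.1 s)
    · exact congrArg _ (D.coe_frame_symm z.1 t)
  constructor
  · rintro ⟨h, h'⟩
    refine ⟨(D.mem_graph_iff _ _).1 h, fun a => ?_⟩
    have := (h' ⟨_, D.graphMap_mem z.1 a⟩).trans (e _ _)
    simpa using this
  · rintro ⟨h, h'⟩
    refine ⟨(D.mem_graph_iff _ _).2 h, fun f => ?_⟩
    refine Eq.trans ?_ (e _ _).symm
    have := h' (D.prA f)
    rwa [D.graphMap_prA z.1 f.2] at this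

theorem exists_extChart_eq (hnd : b.Nondegenerate) {i : ℕ} (D : Splitting K i V) (F : Gr K i V)
    (ω : Alt2 F) {φ : D.A →ₗ[K] D.B} (hφ : D.graph φ = F) :
    ∃ η, extChart hnd D (φ, η) = extGr hnd F ω := by
  subst hφ
  refine ⟨ω.compLinearMap (D.frame φ).toLinearMap, ?_⟩
  rw [extChart]
  congr 1
  ext x
  simp

/-- Equations of the Lagrangian subspace with given coordinates. -/
noncomputable def chartEquations (b : LinearMap.BilinForm K V) {i : ℕ} (D : Splitting K i V)
    (z : (D.A →ₗ[K] D.B) × (D.A [⋀^Fin 2]→ₗ[K] K)) :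
    V × V →ₗ[K] D.B × (D.A →ₗ[K] K) :=
  ((D.prB - z.1 ∘ₗ D.prA) ∘ₗ LinearMap.fst K V V).prod
    ((LinearMap.lcomp K K (D.graphMap z.1) ∘ₗ b) ∘ₗ LinearMap.snd K V V -
      altBilin z.2 ∘ₗ D.prA ∘ₗ LinearMap.fst K V V)

theorem chartEquations_eq_zero_iff (hnd : b.Nondegenerate) {i : ℕ} (D : Splitting K i V)
    (z : (D.A →ₗ[K] D.B) × (D.A [⋀^Fin 2]→ₗ[K] K)) (x : V × V) :
    chartEquations b D z x = 0 ↔ x ∈ (extChart hnd D z).toSubmodule := by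
  rw [mem_extChart, Prod.ext_iff]
  refine and_congr sub_eq_zero (sub_eq_zero.trans ?_)
  rw [LinearMap.ext_iff]
  rfl

theorem isPolyMap_chartEquations {i : ℕ} (D : Splitting K i V) :
    IsPolyMap K (chartEquations b D) := by
  have hfst : IsPolyMap K fun z : (D.A →ₗ[K] D.B) × (D.A [⋀^Fin 2]→ₗ[K] K) => z.1 :=
    IsPolyMap.id.map (LinearMap.fst K (D.A →ₗ[K] D.B) (D.A [⋀^Fin 2]→ₗ[K] K))
  have hsnd : IsPolyMap K fun z : (D.A →ₗ[K] D.B) × (D.A [⋀^Fin 2]→ₗ[K] K) => z.2 :=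
    IsPolyMap.id.map (LinearMap.snd K (D.A →ₗ[K] D.B) (D.A [⋀^Fin 2]→ₗ[K] K))
  refine IsPolyMap.of_apply fun x => IsPolyMap.prodMk ?_ (IsPolyMap.of_apply fun a => ?_)
  · exact (IsPolyMap.const _).sub (hfst.apply _)
  · exact ((((isPolyMap_graphMap D).comp hfst).apply a).map (b x.2)).sub
      (isPolyMap_alt_apply hsnd _ _)

/-- The map from the bundle `Λ²S*` to the Grassmannian is rational in charts. -/
theorem rational_extChart (hnd : b.Nondegenerate) {i : ℕ} (D : Splitting K i V)
    (z₀ : (D.A →ₗ[K] D.B) × (D.A [⋀^Fin 2]→ₗ[K] K)) :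
    ∃ (D₂ : Splitting K (finrank K V) (V × V))
      (f : (D.A →ₗ[K] D.B) × (D.A [⋀^Fin 2]→ₗ[K] K) → D₂.A →ₗ[K] D₂.B),
      RationalAt K f z₀ ∧ NearAt K (fun z => extChart hnd D z = D₂.graph (f z)) z₀ := by
  set L₀ := extChart hnd D z₀ with hL₀
  obtain ⟨B, hB⟩ := Submodule.exists_isCompl L₀.toSubmodule
  let D₂ : Splitting K (finrank K V) (V × V) := ⟨L₀.toSubmodule, B, hB, L₀.finrank_eq⟩
  -- Both sides equal r = dim V: on the left dim B + dim A, on the right 2r - r. Identifying the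
  -- target of the equations with `D₂.B` makes their restriction to `D₂.B` an endomorphism, which is
  -- injective at `z₀` because `D₂.B` is a complement of the kernel.
  have hdim : finrank K (D.B × (D.A →ₗ[K] K)) = finrank K D₂.B := by
    have h1 := Submodule.finrank_add_eq_of_isCompl D.isCompl
    have h2 := Submodule.finrank_add_eq_of_isCompl D₂.isCompl
    rw [D₂.finrank_eq, Module.finrank_prod] at h2
    rw [Module.finrank_prod, Subspace.dual_finrank_eq]
    omega
  let ρ := LinearEquiv.ofFinrankEq _ _ hdim
  let Θ : (D.A →ₗ[K] D.B) × (D.A [⋀^Fin 2]→ₗ[K] K) → V × V →ₗ[K] D₂.B :=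
    fun z => ρ.toLinearMap ∘ₗ chartEquations b D z
  have hΘ : IsPolyMap K Θ := (IsPolyMap.const _).llcomp (isPolyMap_chartEquations D)
  have hΘ0 : ∀ z x, Θ z x = 0 ↔ x ∈ (extChart hnd D z).toSubmodule := fun z x =>
    ρ.map_eq_zero_iff.trans (chartEquations_eq_zero_iff hnd D z x)
  have hB1 : IsPolyMap K fun z => Θ z ∘ₗ D₂.B.subtype := hΘ.llcomp (.const _)
  have hB2 : IsUnit (Θ z₀ ∘ₗ D₂.B.subtype) := by
    have : Function.Injective (Θ z₀ ∘ₗ D₂.B.subtype) := by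
      rw [← LinearMap.ker_eq_bot, LinearMap.ker_eq_bot']
      intro y hy
      exact Subtype.ext (Submodule.disjoint_def.1 hB.disjoint _ ((hΘ0 z₀ y).1 hy) y.2)
    exact (Module.End.isUnit_iff _).2 ⟨this, LinearMap.injective_iff_surjective.1 this⟩
  refine ⟨D₂, fun z =>
    -(Ring.inverse (Θ z ∘ₗ D₂.B.subtype) ∘ₗ (Θ z ∘ₗ D₂.A.subtype)), ?_, ?_⟩
  · exact ((RationalAt.ringInverse hB1 hB2).llcomp
      ((hΘ.llcomp (.const _)).rationalAt z₀)).neg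
  · exact (NearAt.isUnit hB1 hB2).mono fun z hz =>
      (D₂.graph_eq_of_le_ker hz fun x hx => (hΘ0 z x).2 hx).symm

/-- The coordinates `(F, ω)` of a Lagrangian subspace are rational in charts. -/
theorem rational_coordinates (hK : ringChar K ≠ 2) (hnd : b.Nondegenerate) (hsymm : b.IsSymm)
    {i : ℕ} (D : Splitting K i V) (φ₀ : D.A →ₗ[K] D.B)
    (D₂ : Splitting K (finrank K V) (V × V)) (h₀ : baseOf D₂.A = (D.graph φ₀).toSubmodule) :
    ∃ f : (D₂.A →ₗ[K] D₂.B) → (D.A →ₗ[K] D.B) × (D.A [⋀^Fin 2]→ₗ[K] K), RationalAt K f 0 ∧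
      NearAt K (fun ψ => D₂.graph ψ ∈ OGrEps b →
        finrank K (baseOf (D₂.graph ψ).toSubmodule) = i →
          extChart hnd D (f ψ) = D₂.graph ψ) 0 := by
  -- Here σ lifts A into the center `D₂.A` of the chart. Transporting it along the graph of ψ gives
  -- vectors `S ψ` of the moving subspace, and their first components `M ψ` project isomorphically
  -- to A near ψ = 0. They span π(L) when dim π(L) = i.
  obtain ⟨σ, hσ⟩ := (D.prA ∘ₗ LinearMap.fst K V V ∘ₗ
    D₂.A.subtype).exists_rightInverse_of_surjective (by
      rw [LinearMap.range_eq_top]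
      intro a
      have : D.graphMap φ₀ a ∈ baseOf D₂.A := h₀ ▸ D.graphMap_mem φ₀ a
      obtain ⟨x, hx, hxa⟩ := this
      refine ⟨⟨x, hx⟩, ?_⟩
      change D.prA (LinearMap.fst K V V x) = a
      rw [hxa, D.prA_graphMap])
  let S : (D₂.A →ₗ[K] D₂.B) → D.A →ₗ[K] V × V := fun ψ => D₂.graphMap ψ ∘ₗ σ
  have hS : IsPolyMap K S := (isPolyMap_graphMap D₂).llcomp (.const σ)
  have hSmem : ∀ ψ a, S ψ a ∈ (D₂.graph ψ).toSubmodule := fun ψ a => ⟨σ a, rfl⟩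
  let M : (D₂.A →ₗ[K] D₂.B) → D.A →ₗ[K] V := fun ψ => LinearMap.fst K V V ∘ₗ S ψ
  have hM : IsPolyMap K M := (IsPolyMap.const _).llcomp hS
  have hu : IsPolyMap K fun ψ => D.prA ∘ₗ M ψ := (IsPolyMap.const _).llcomp hM
  have hu0 : D.prA ∘ₗ M 0 = 1 := by
    rw [← Module.End.one_eq_id] at hσ
    rw [← hσ]
    ext a
    simp [M, S, Splitting.graphMap]
  have hunit : IsUnit (D.prA ∘ₗ M 0) := hu0 ▸ isUnit_one
  let I := fun ψ => Ring.inverse (D.prA ∘ₗ M ψ)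
  have hI : RationalAt K I 0 := RationalAt.ringInverse hu hunit
  let φ : (D₂.A →ₗ[K] D₂.B) → D.A →ₗ[K] D.B := fun ψ => (D.prB ∘ₗ M ψ) ∘ₗ I ψ
  have hφ : RationalAt K φ 0 := (((IsPolyMap.const _).llcomp hM).rationalAt 0).llcomp hI
  let c : (D₂.A →ₗ[K] D₂.B) → D.A →ₗ[K] V := fun ψ => (LinearMap.snd K V V ∘ₗ S ψ) ∘ₗ I ψ
  have hc : RationalAt K c 0 := (((IsPolyMap.const _).llcomp hS).rationalAt 0).llcomp hI
  let β : (D₂.A →ₗ[K] D₂.B) → D.A →ₗ[K] D.A →ₗ[K] K :=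
    fun ψ => (LinearMap.llcomp K D.A V K).flip (D.graphMap (φ ψ)) ∘ₗ b ∘ₗ c ψ
  have hg : RationalAt K (fun ψ => D.graphMap (φ ψ)) 0 :=
    (((IsPolyMap.const D.A.subtype).rationalAt 0).add
      (hφ.map (LinearMap.llcomp K D.A D.B V D.B.subtype)))
  have hβ : RationalAt K β 0 :=
    (hg.map (LinearMap.llcomp K D.A V K).flip).llcomp
      (((IsPolyMap.const b).rationalAt 0).llcomp hc)
  refine ⟨fun ψ => (φ ψ, skewPart (β ψ)), hφ.prodMk (hβ.map skewPart),
    (NearAt.isUnit hu hunit).mono fun ψ hψ hL hi => ?_⟩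
  have hF : D.graph (φ ψ) = ⟨baseOf (D₂.graph ψ).toSubmodule, hi⟩ :=
    D.graph_eq_of_range_le hψ fun a => ⟨_, hSmem ψ a, rfl⟩
  obtain ⟨ω, hω⟩ := exists_eq_extGr hK hnd hsymm hL (D.graph (φ ψ)) (by rw [hF])
  obtain ⟨η, hη⟩ := exists_extChart_eq hnd D (D.graph (φ ψ)) ω rfl
  have hηβ : ∀ x y, β ψ x y = η ![x, y] := fun x y => by
    have h1 : S ψ (I ψ x) ∈ (extChart hnd D (φ ψ, η)).toSubmodule := by
      rw [hη, ← hω]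
      exact hSmem _ _
    have h2 := ((mem_extChart hnd D _ _).1 h1).2 y
    have h3 : D.prA (S ψ (I ψ x)).1 = x := LinearMap.congr_fun (Ring.mul_inverse_cancel _ hψ) x
    rw [h3] at h2
    exact h2
  -- On Lagrangian points `β ψ` is already alternating, so `skewPart` changes nothing there.
  -- Elsewhere in the chart it ensures that the formula still takes values in alternating forms.
  have hη' : skewPart (β ψ) = η := by
    refine alt_ext fun x y => ?_
    have h2K : (2 : K) ≠ 0 := Ring.two_ne_zero hK
    have h3 : η ![y, x] = -η ![x, y] := by
      have := alt_self η (x + y)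
      simp only [← altBilin_apply, map_add, LinearMap.add_apply] at this ⊢
      rw [altBilin_apply η x x, altBilin_apply η y y, alt_self, alt_self] at this
      linear_combination this
    rw [skewPart_apply, hηβ, hηβ, h3]
    field_simp
    ring
  change extChart hnd D (φ ψ, skewPart (β ψ)) = _
  rw [hη', hη, ← hω]

end ChartRegularity

end LagrangianDual

namespace LagrangianDual

open Module

/-! ### The strata as total spaces of vector bundles -/

section Bundle

variable {K : Type u} [Field K] {V : Type v} [AddCommGroup V] [Module K V]
variable [FiniteDimensional K V] {b : LinearMap.BilinForm K V}

theorem extGr_sigma_injective (hnd : b.Nondegenerate) {i : ℕ} {t t' : Σ F : Gr K i V, Alt2 F}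
    (h : extGr hnd t.1 t.2 = extGr hnd t'.1 t'.2) : t = t' := by
  obtain ⟨F, ω⟩ := t
  obtain ⟨F', ω'⟩ := t'
  have h' : extensionOf b F ω = extensionOf b F' ω' := congrArg Gr.toSubmodule h
  obtain rfl : F = F' := by
    ext1
    rw [← baseOf_extensionOf hnd F ω, h', baseOf_extensionOf hnd]
  rw [extGr_ext hnd h']

/-- The bijection `(F, ω) ↦ L` from the total space of `Λ²S*` to a stratum of `OΣ`. -/
noncomputable def bundleEquiv (hK : ringChar K ≠ 2) (hnd : b.Nondegenerate) (hsymm : b.IsSymm)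
    (i : ℕ) : {t : Σ F : Gr K i V, Alt2 F | t.1 ∈ OGr b i} ≃ OSigmaStratum b i :=
  Equiv.ofBijective
    (fun t => ⟨extGr hnd t.1.1 t.1.2, extGr_mem_OSigmaStratum hK hnd hsymm t.2 t.1.2⟩) <| by
    constructor
    · intro t t' h
      exact Subtype.ext (extGr_sigma_injective hnd (congrArg Subtype.val h))
    · rintro ⟨L, hL, hi⟩
      obtain ⟨ω, hω⟩ := exists_eq_extGr hK hnd hsymm hL.1 ⟨baseOf L.toSubmodule, hi⟩ rfl
      refine ⟨⟨⟨⟨baseOf L.toSubmodule, hi⟩, ω⟩, fun x hx => ?_⟩, Subtype.ext hω.symm⟩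
      exact (mem_OSigma_iff_baseOf hK hnd hsymm hL.1).1 hL x hx x hx

variable (hK : ringChar K ≠ 2) (hnd : b.Nondegenerate) (hsymm : b.IsSymm) {i : ℕ}

theorem bundleEquiv_apply (t : {t : Σ F : Gr K i V, Alt2 F | t.1 ∈ OGr b i}) :
    (bundleEquiv hK hnd hsymm i t : Gr K (finrank K V) (V × V)) = extGr hnd t.1.1 t.1.2 := rfl

theorem extGr_bundleEquiv_symm (L : OSigmaStratum b i) :
    extGr hnd ((bundleEquiv hK hnd hsymm i).symm L).1.1 ((bundleEquiv hK hnd hsymm i).symm L).1.2 =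
      L.1 := by
  rw [← bundleEquiv_apply hK hnd hsymm, Equiv.apply_symm_apply]

theorem bundleEquiv_symm_eq {L : OSigmaStratum b i} {t : Σ F : Gr K i V, Alt2 F}
    (h : extGr hnd t.1 t.2 = L.1) : ((bundleEquiv hK hnd hsymm i).symm L).1 = t :=
  extGr_sigma_injective hnd ((extGr_bundleEquiv_symm hK hnd hsymm L).trans h.symm)

theorem bundleEquiv_symm_base (L : OSigmaStratum b i) :
    ((bundleEquiv hK hnd hsymm i).symm L).1.1.toSubmodule = baseOf L.1.toSubmodule := by
  conv_rhs => rw [← extGr_bundleEquiv_symm hK hnd hsymm L]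
  exact (baseOf_extensionOf hnd _ _).symm

/-- This one local formula for the inverse serves the projection, the trivializations and
biregularity. The chart D may be any one whose cell contains π(L); trivializing over a whole cell
with D fixed needs this freedom. -/
theorem exists_chart_bundleEquiv_symm (L : OSigmaStratum b i) (D : Splitting K i V)
    (hD : ((bundleEquiv hK hnd hsymm i).symm L).1.1 ∈ Set.range D.graph) :
    ∃ (D₂ : Splitting K (finrank K V) (V × V))
      (p : (D₂.A →ₗ[K] D₂.B) → (D.A →ₗ[K] D.B) × (D.A [⋀^Fin 2]→ₗ[K] K))
      (q : (D₂.A →ₗ[K] D₂.B) → K),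
      D₂.graph 0 = L.1 ∧ IsPolyMap K p ∧ q ∈ polyFun K (D₂.A →ₗ[K] D₂.B) ∧ q 0 ≠ 0 ∧
      ∀ (ψ : D₂.A →ₗ[K] D₂.B) (h : D₂.graph ψ ∈ OSigmaStratum b i), q ψ ≠ 0 →
        ((bundleEquiv hK hnd hsymm i).symm ⟨D₂.graph ψ, h⟩).1 =
          (altAtlas K i V).chart D ((q ψ)⁻¹ • p ψ) := by
  obtain ⟨D₂, hD₂⟩ := L.1.exists_splitting
  obtain ⟨φ₀, hφ₀⟩ := hD
  have hA : D₂.A = L.1.toSubmodule := by rw [← hD₂, D₂.graph_zero]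
  obtain ⟨f, hf, hfn⟩ := rational_coordinates hK hnd hsymm D φ₀ D₂
    (by rw [hφ₀, bundleEquiv_symm_base, hA])
  obtain ⟨p, q, hp, hq, hq0, h⟩ := hf.exists_and hfn
  refine ⟨D₂, p, q, hD₂, hp, hq, hq0, fun ψ hψ hqψ => ?_⟩
  obtain ⟨h1, h2⟩ := h ψ hqψ
  exact (bundleEquiv_symm_eq hK hnd hsymm (L := ⟨D₂.graph ψ, hψ⟩)
    (t := (altAtlas K i V).chart D (f ψ)) (h2 hψ.1.1 hψ.2)).trans
    (congrArg ((altAtlas K i V).chart D) h1)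

theorem isBiregular_bundleEquiv :
    IsBiregular (altAtlas K i V) (Gr.atlas K (finrank K V) (V × V))
      (bundleEquiv hK hnd hsymm i) := by
  constructor
  · intro t
    obtain ⟨D, c, hc⟩ := (altAtlas K i V).covers t.1
    obtain ⟨D₂, f, hf, hfn⟩ := rational_extChart hnd D c
    obtain ⟨p, q, hp, hq, hq0, h⟩ := hf.exists_and hfn
    refine ⟨D, c, D₂, p, q, hc, hp, hq, hq0, fun z hz hqz => ?_⟩
    obtain ⟨h1, h2⟩ := h z hqz
    exact h2.trans (congrArg D₂.graph h1)
  · intro L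
    obtain ⟨D, hD⟩ := ((bundleEquiv hK hnd hsymm i).symm L).1.1.exists_splitting
    obtain ⟨D₂, p, q, hD₂, hp, hq, hq0, h⟩ :=
      exists_chart_bundleEquiv_symm hK hnd hsymm L D ⟨0, hD⟩
    exact ⟨D₂, (0 : D₂.A →ₗ[K] D₂.B), D, p, q, hD₂, hp, hq, hq0, h⟩

/-- The identification of a subspace in the cell of a chart with the model subspace. -/
noncomputable def Splitting.cellFrame (D : Splitting K i V) (F : Gr K i V)
    (hF : F ∈ Set.range D.graph) : F.toSubmodule ≃ₗ[K] D.A :=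
  LinearEquiv.ofInjectiveOfFinrankEq (D.prA.domRestrict F.toSubmodule)
    (by obtain ⟨φ, rfl⟩ := hF; exact D.injective_of_graph φ) (by rw [F.finrank_eq, D.finrank_eq])

theorem Splitting.cellFrame_graph (D : Splitting K i V) (φ : D.A →ₗ[K] D.B) :
    D.cellFrame (D.graph φ) ⟨φ, rfl⟩ = (D.frame φ).symm := by
  ext1 x
  exact (D.coe_frame_symm φ x).symm

theorem finiteDimensional_alt {A : Type*} [AddCommGroup A] [Module K A] [FiniteDimensional K A] :
    FiniteDimensional K (A [⋀^Fin 2]→ₗ[K] K) :=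
  FiniteDimensional.of_injective
    (AlternatingMap.toMultilinearMapLM (R := K) (S := K) (M := A) (N := K) (ι := Fin 2))
    AlternatingMap.coe_multilinearMap_injective

/-- Over the cell of a chart D, the projection along `D.B` identifies each F with `D.A`, and thereby
Λ²F* with the fixed space Λ²(`D.A`)*. In the coordinates of `altAtlas` this trivialization just
reads off the second component. -/
theorem isAlgVectorBundle_bundleEquiv :
    IsAlgVectorBundle (Gr.atlas K (finrank K V) (V × V)) (OSigmaStratum b i)
      (Gr.atlas K i V) (OGr b i) (fun F => Alt2 F) (bundleEquiv hK hnd hsymm i) := by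
  refine ⟨fun L => ?_, fun F₀ _ => ?_⟩
  · obtain ⟨D, hD⟩ := ((bundleEquiv hK hnd hsymm i).symm L).1.1.exists_splitting
    obtain ⟨D₂, p, q, hD₂, hp, hq, hq0, h⟩ :=
      exists_chart_bundleEquiv_symm hK hnd hsymm L D ⟨0, hD⟩
    exact ⟨D₂, (0 : D₂.A →ₗ[K] D₂.B), D, fun z => (p z).1, q, hD₂, hp.map (LinearMap.fst K _ _), hq, hq0,
      fun z hz hqz => congrArg Sigma.fst (h z hz hqz)⟩
  · obtain ⟨D, hD⟩ := F₀.exists_splitting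
    have := finiteDimensional_alt (K := K) (A := D.A)
    let θ : (D.A [⋀^Fin 2]→ₗ[K] K) ≃ₗ[K] (Fin (finrank K (D.A [⋀^Fin 2]→ₗ[K] K)) → K) :=
      (Module.finBasis K _).equivFun
    let τ : ∀ F : Gr K i V, F ∈ OGr b i ∩ Set.range D.graph → (Alt2 F ≃ₗ[K] (Fin _ → K)) :=
      fun F hF => (AlternatingMap.domLCongr K K (Fin 2) K (D.cellFrame F hF.2)).trans θ
    have hτ : ∀ (t : Σ F : Gr K i V, Alt2 F) (ht : t.1 ∈ OGr b i ∩ Set.range D.graph)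
        (w : (D.A →ₗ[K] D.B) × (D.A [⋀^Fin 2]→ₗ[K] K)), t = (altAtlas K i V).chart D w →
        τ t.1 ht t.2 = θ w.2 := by
      rintro t ht w rfl
      refine congrArg θ ?_
      ext x
      change w.2 _ = _
      congr 1
      ext j : 1
      change (D.frame w.1).symm ((D.cellFrame (D.graph w.1) ⟨w.1, rfl⟩).symm (x j)) = _
      rw [D.cellFrame_graph, LinearEquiv.symm_symm, LinearEquiv.symm_apply_apply]
    have hτ' : ∀ (φ : D.A →ₗ[K] D.B) (h : D.graph φ ∈ OGr b i ∩ Set.range D.graph) (v),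
        (τ (D.graph φ) h).symm v = (θ.symm v).compLinearMap (D.frame φ).symm.toLinearMap := by
      intro φ h v
      rw [LinearEquiv.symm_apply_eq]
      have := hτ ⟨D.graph φ, (θ.symm v).compLinearMap (D.frame φ).symm.toLinearMap⟩ h
        (φ, θ.symm v) rfl
      rw [this, LinearEquiv.apply_symm_apply]
    refine ⟨Set.range D.graph, D.isOpen_range_graph, ⟨0, hD⟩, _, τ, ?_, ?_⟩
    · rintro ⟨L, hL, hLU⟩
      obtain ⟨D₂, p, q, hD₂, hp, hq, hq0, h⟩ :=
        exists_chart_bundleEquiv_symm hK hnd hsymm ⟨L, hL⟩ D hLU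
      refine ⟨D₂, (0 : D₂.A →ₗ[K] D₂.B), (), fun z => θ (p z).2, q, hD₂,
        (hp.map (LinearMap.snd K _ _)).map θ.toLinearMap, hq, hq0, fun z hz hqz => ?_⟩
      refine (hτ _ ⟨((bundleEquiv hK hnd hsymm i).symm ⟨_, hz.1⟩).2, hz.2⟩ _ (h z hz.1 hqz)).trans ?_
      exact map_smul θ _ _
    · rintro ⟨⟨F, v⟩, hx⟩
      obtain ⟨φ₀, hφ₀⟩ := hx.1.2
      obtain ⟨D₂, f, hf, hfn⟩ := rational_extChart hnd D (φ₀, θ.symm v)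
      let g : (D.A →ₗ[K] D.B) × (Fin _ → K) →ₗ[K] (D.A →ₗ[K] D.B) × (D.A [⋀^Fin 2]→ₗ[K] K) :=
        LinearMap.prodMap LinearMap.id θ.symm.toLinearMap
      have hf' : RationalAt K (fun z => f (g z)) (φ₀, v) := RationalAt.comp (g := g) hf (.linear g)
      have hfn' : NearAt K (fun z => extChart hnd D (g z) = D₂.graph (f (g z))) (φ₀, v) :=
        NearAt.comp (g := g) (z₀ := (φ₀, v)) hfn (.linear g)
      obtain ⟨p, q, hp, hq, hq0, h⟩ := hf'.exists_and hfn'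
      refine ⟨(D, ()), (φ₀, v), D₂, p, q, Prod.ext hφ₀ rfl, hp, hq, hq0, fun z hz hqz => ?_⟩
      obtain ⟨h1, h2⟩ := h z hqz
      refine Eq.trans ?_ (h2.trans (congrArg D₂.graph h1))
      exact congrArg (extGr hnd (D.graph z.1)) (hτ' z.1 hz.1 z.2)

end Bundle

end LagrangianDual

namespace LagrangianDual

open Module

/-! ### Connecting points by preconnected subsets -/

section Connecting

variable {X : Type*} [TopologicalSpace X] {S T : Set X} {x y z : X}

/-- The points `x` and `y` lie in a common preconnected subset of `S`. -/
def ConnectedThrough (S : Set X) (x y : X) : Prop :=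
  ∃ T ⊆ S, IsPreconnected T ∧ x ∈ T ∧ y ∈ T

theorem ConnectedThrough.refl (h : x ∈ S) : ConnectedThrough S x x :=
  ⟨{x}, by simpa using h, isPreconnected_singleton, rfl, rfl⟩

theorem ConnectedThrough.symm (h : ConnectedThrough S x y) : ConnectedThrough S y x := by
  obtain ⟨T, hT, h, hx, hy⟩ := h
  exact ⟨T, hT, h, hy, hx⟩

theorem ConnectedThrough.trans (h : ConnectedThrough S x y) (h' : ConnectedThrough S y z) :
    ConnectedThrough S x z := by
  obtain ⟨T, hT, h, hx, hy⟩ := h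
  obtain ⟨T', hT', h', hy', hz⟩ := h'
  exact ⟨T ∪ T', Set.union_subset hT hT', h.union y hy hy' h', Or.inl hx, Or.inr hz⟩

theorem ConnectedThrough.mono (hST : S ⊆ T) (h : ConnectedThrough S x y) :
    ConnectedThrough T x y := by
  obtain ⟨U, hU, h⟩ := h
  exact ⟨U, hU.trans hST, h⟩

theorem ConnectedThrough.mem_connectedComponentIn (h : ConnectedThrough S x y) :
    y ∈ connectedComponentIn S x := by
  obtain ⟨T, hT, h, hx, hy⟩ := h
  exact h.subset_connectedComponentIn hx hT hy

theorem ConnectedThrough.of_line {K : Type*} [Field K] [Infinite K] {γ : K → X}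
    (hγ : @Continuous _ _ (zariski K K) _ γ) (hS : ∀ s, γ s ∈ S) (s t : K) :
    ConnectedThrough S (γ s) (γ t) := by
  let _ := zariski K K
  exact ⟨γ '' Set.univ, by rintro _ ⟨s, -, rfl⟩; exact hS s,
    isPreconnected_univ_zariski_line.image γ hγ.continuousOn, ⟨s, trivial, rfl⟩, ⟨t, trivial, rfl⟩⟩

end Connecting

/-! ### One-parameter families of Lagrangian subspaces -/

section Families

variable {K : Type u} [Field K] {V : Type v} [AddCommGroup V] [Module K V]
variable [FiniteDimensional K V] {b : LinearMap.BilinForm K V}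

theorem isPolyMap_quadratic {E : Type*} [AddCommGroup E] [Module K E] (x y z : E) :
    IsPolyMap K (fun s : K => x + s • y + (s * s) • z) := by
  have h : (fun s : K => s) ∈ polyFun K K := dual_mem_polyFun (LinearMap.id : K →ₗ[K] K)
  exact ((IsPolyMap.const x).add (.smul h (.const y))).add (.smul (mul_mem_polyFun h h) (.const z))

theorem continuous_extChart_comp (hnd : b.Nondegenerate) {i : ℕ} (D : Splitting K i V)
    {g : K → (D.A →ₗ[K] D.B) × (D.A [⋀^Fin 2]→ₗ[K] K)} (hg : IsPolyMap K g) :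
    @Continuous _ _ (zariski K K) _ (fun s => extChart hnd D (g s)) := by
  refine continuous_of_rational fun s₀ => ?_
  obtain ⟨D₂, f, hf, hfn⟩ := rational_extChart hnd D (g s₀)
  exact ⟨D₂, fun s => f (g s), hf.comp hg, hfn.comp hg⟩

theorem baseOf_extGr (hnd : b.Nondegenerate) {i : ℕ} (F : Gr K i V) (ω : Alt2 F) :
    baseOf (extGr hnd F ω).toSubmodule = F.toSubmodule := baseOf_extensionOf hnd F ω

theorem extChart_mem_OGrEps (hnd : b.Nondegenerate) (hsymm : b.IsSymm) {i : ℕ}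
    (D : Splitting K i V) (z : (D.A →ₗ[K] D.B) × (D.A [⋀^Fin 2]→ₗ[K] K)) :
    extChart hnd D z ∈ OGrEps b := extGr_mem_OGrEps hnd hsymm _ _

theorem baseOf_extChart (hnd : b.Nondegenerate) {i : ℕ} (D : Splitting K i V)
    (z : (D.A →ₗ[K] D.B) × (D.A [⋀^Fin 2]→ₗ[K] K)) :
    baseOf (extChart hnd D z).toSubmodule = (D.graph z.1).toSubmodule := baseOf_extGr hnd _ _

/-- The Lagrangians with given projection F form the vector space Λ²F*; the two points are joined by
the affine line through their forms. -/
theorem connectedThrough_of_baseOf_eq [Infinite K] (hK : ringChar K ≠ 2) (hnd : b.Nondegenerate)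
    (hsymm : b.IsSymm) {L M : Gr K (finrank K V) (V × V)} (hL : L ∈ OGrEps b) (hM : M ∈ OGrEps b)
    (h : baseOf L.toSubmodule = baseOf M.toSubmodule) :
    ConnectedThrough {N | N ∈ OGrEps b ∧ baseOf N.toSubmodule = baseOf L.toSubmodule} L M := by
  let F : Gr K (finrank K (baseOf L.toSubmodule)) V := ⟨baseOf L.toSubmodule, rfl⟩
  obtain ⟨ω, hω⟩ := exists_eq_extGr hK hnd hsymm hL F rfl
  obtain ⟨ω', hω'⟩ := exists_eq_extGr hK hnd hsymm hM F h
  obtain ⟨D, hD⟩ := F.exists_splitting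
  obtain ⟨η, hη⟩ := exists_extChart_eq hnd D F ω hD
  obtain ⟨η', hη'⟩ := exists_extChart_eq hnd D F ω' hD
  have hg : IsPolyMap K fun s : K => ((0 : D.A →ₗ[K] D.B), η + s • (η' - η) + (s * s) • (0 : _)) :=
    (IsPolyMap.const _).prodMk (isPolyMap_quadratic _ _ _)
  have := ConnectedThrough.of_line
    (S := {N | N ∈ OGrEps b ∧ baseOf N.toSubmodule = baseOf L.toSubmodule})
    (continuous_extChart_comp hnd D hg)
    (fun s => ⟨extChart_mem_OGrEps hnd hsymm _ _, by rw [baseOf_extChart, hD]⟩) 0 1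
  simpa [hη, hη', ← hω, ← hω'] using this

/-- The infinitesimal shear `(a, c) ↦ (b(c, p₁) p₂ - b(c, p₂) p₁, 0)`. -/
def shear (b : LinearMap.BilinForm K V) (p₁ p₂ : V) : V × V →ₗ[K] V × V :=
  LinearMap.inl K V V ∘ₗ ((b.flip p₁).smulRight p₂ - (b.flip p₂).smulRight p₁) ∘ₗ
    LinearMap.snd K V V

omit [FiniteDimensional K V] in
theorem shear_apply (p₁ p₂ : V) (x : V × V) :
    shear b p₁ p₂ x = (b x.2 p₁ • p₂ - b x.2 p₂ • p₁, 0) := rfl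

omit [FiniteDimensional K V] in
-- The shear depends only on the second component and has values in the first, so it squares to zero
-- and 1 + sN is unipotent.
theorem shear_injective (p₁ p₂ : V) (s : K) :
    Function.Injective ((LinearMap.id : V × V →ₗ[K] V × V) + s • shear b p₁ p₂) := by
  rw [← LinearMap.ker_eq_bot, LinearMap.ker_eq_bot']
  rintro ⟨a, c⟩ h
  simp only [LinearMap.add_apply, LinearMap.id_apply, LinearMap.smul_apply, shear_apply,
    Prod.smul_mk, Prod.mk_add_mk, smul_zero, add_zero, Prod.mk_eq_zero] at h
  obtain ⟨h1, rfl⟩ := h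
  simpa using h1

/-- The image of `L` under the unipotent map `1 + s N`, `N` a shear. -/
def shearGr (b : LinearMap.BilinForm K V) (p₁ p₂ : V) (L : Gr K (finrank K V) (V × V)) (s : K) :
    Gr K (finrank K V) (V × V) where
  toSubmodule := L.toSubmodule.map (LinearMap.id + s • shear b p₁ p₂)
  finrank_eq := by
    rw [← (Submodule.equivMapOfInjective _ (shear_injective p₁ p₂ s) L.toSubmodule).finrank_eq,
      L.finrank_eq]

omit [FiniteDimensional K V] in
theorem shearGr_zero (p₁ p₂ : V) (L : Gr K (finrank K V) (V × V)) :
    shearGr b p₁ p₂ L 0 = L := by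
  ext1
  simp [shearGr]

theorem continuous_shearGr (p₁ p₂ : V) (L : Gr K (finrank K V) (V × V)) :
    @Continuous _ _ (zariski K K) _ (shearGr b p₁ p₂ L) := by
  refine continuous_map_of_isPolyMap L (M := fun s => LinearMap.id + s • shear b p₁ p₂) ?_
    fun s => rfl
  simpa using isPolyMap_quadratic LinearMap.id (shear b p₁ p₂) 0

omit [FiniteDimensional K V] in
-- The vector b(c, p₁) p₂ - b(c, p₂) p₁ is orthogonal to c, so 1 + sN preserves the quadratic form
-- b(a, c).
theorem shearGr_mem_OGrEps (hsymm : b.IsSymm) (p₁ p₂ : V) {L : Gr K (finrank K V) (V × V)}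
    (hL : L ∈ OGrEps b) (s : K) : shearGr b p₁ p₂ L s ∈ OGrEps b := by
  rintro _ ⟨x, hx, rfl⟩
  have h := hL x hx
  rw [q₂_snd] at h ⊢
  simp only [LinearMap.add_apply, LinearMap.id_apply, LinearMap.smul_apply, shear_apply,
    Prod.fst_add, Prod.snd_add, Prod.smul_fst, Prod.smul_snd, smul_zero, add_zero, map_add,
    map_smul, map_sub, LinearMap.sub_apply, smul_eq_mul]
  rw [hsymm.eq p₁ x.2, hsymm.eq p₂ x.2]
  linear_combination h

omit [FiniteDimensional K V] in
theorem baseOf_shearGr_le (p₁ p₂ : V) (L : Gr K (finrank K V) (V × V)) (s : K) :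
    baseOf (shearGr b p₁ p₂ L s).toSubmodule ≤ baseOf L.toSubmodule ⊔ Submodule.span K {p₁, p₂} := by
  rintro _ ⟨_, ⟨x, hx, rfl⟩, rfl⟩
  refine Submodule.add_mem_sup (⟨x, hx, rfl⟩ : x.1 ∈ baseOf L.toSubmodule) ?_
  have h1 : p₁ ∈ Submodule.span K {p₁, p₂} := Submodule.subset_span (by simp)
  have h2 : p₂ ∈ Submodule.span K {p₁, p₂} := Submodule.subset_span (by simp)
  exact Submodule.smul_mem _ _ (sub_mem (Submodule.smul_mem _ _ h2) (Submodule.smul_mem _ _ h1))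

theorem notMem_of_finrank_sup {F : Submodule K V} {p₁ p₂ : V}
    (hd : finrank K (F ⊔ Submodule.span K {p₁, p₂} : Submodule K V) = finrank K F + 2) :
    p₁ ∉ F ⊔ Submodule.span K {p₂} := by
  intro h
  have h1 : F ⊔ Submodule.span K {p₁, p₂} ≤ F ⊔ Submodule.span K {p₂} := by
    refine sup_le le_sup_left (Submodule.span_le.2 ?_)
    rintro x (rfl | rfl)
    · exact h
    · exact Submodule.mem_sup_right (Submodule.mem_span_singleton_self _)
  have h2 := Submodule.finrank_mono h1
  have h3 := Submodule.finrank_add_le_finrank_add_finrank F (Submodule.span K {p₂})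
  have h4 : finrank K (Submodule.span K {p₂}) ≤ 1 := by
    simpa using finrank_span_le_card (R := K) ({p₂} : Set V)
  omega

/-- A functional separating p₁ from F + ⟨p₂⟩ is b(c, ·) with c ∈ F^⊥, so (0, c) ∈ L. The sheared
vector projects to s b(c, p₁) p₂, a nonzero multiple of p₂. -/
theorem mem_baseOf_shearGr (hK : ringChar K ≠ 2) (hnd : b.Nondegenerate) (hsymm : b.IsSymm)
    {p₁ p₂ : V} {L : Gr K (finrank K V) (V × V)} (hL : L ∈ OGrEps b) {s : K} (hs : s ≠ 0)
    (h : p₁ ∉ baseOf L.toSubmodule ⊔ Submodule.span K {p₂}) :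
    p₂ ∈ baseOf (shearGr b p₁ p₂ L s).toSubmodule := by
  obtain ⟨l, hl, hl'⟩ := Submodule.exists_le_ker_of_notMem h
  obtain ⟨c, rfl⟩ := (b.toDual hnd).surjective l
  simp only [LinearMap.BilinForm.toDual_def] at hl hl'
  have h1 : (0, c) ∈ L.toSubmodule := (zero_mem_iff hK hnd hsymm hL c).2 fun f hf =>
    hl' (Submodule.mem_sup_left hf)
  have h2 : b c p₂ = 0 :=
    hl' (Submodule.mem_sup_right (Submodule.mem_span_singleton_self p₂))
  have h3 : s • b c p₁ • p₂ ∈ baseOf (shearGr b p₁ p₂ L s).toSubmodule := by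
    refine ⟨_, ⟨(0, c), h1, rfl⟩, ?_⟩
    simp [shear_apply, h2]
  rw [smul_smul] at h3
  exact (Submodule.smul_mem_iff _ (mul_ne_zero hs hl)).1 h3

omit [FiniteDimensional K V] in
theorem shear_swap (p₁ p₂ : V) : shear b p₂ p₁ = -shear b p₁ p₂ := by
  ext x <;> simp [shear_apply]

theorem baseOf_shearGr (hK : ringChar K ≠ 2) (hnd : b.Nondegenerate) (hsymm : b.IsSymm)
    {p₁ p₂ : V} {L : Gr K (finrank K V) (V × V)} (hL : L ∈ OGrEps b) {s : K} (hs : s ≠ 0)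
    (hd : finrank K (baseOf L.toSubmodule ⊔ Submodule.span K {p₁, p₂} : Submodule K V) =
      finrank K (baseOf L.toSubmodule) + 2) :
    baseOf (shearGr b p₁ p₂ L s).toSubmodule = baseOf L.toSubmodule ⊔ Submodule.span K {p₁, p₂} := by
  have h2 : p₂ ∈ baseOf (shearGr b p₁ p₂ L s).toSubmodule :=
    mem_baseOf_shearGr hK hnd hsymm hL hs (notMem_of_finrank_sup hd)
  have h1 : p₁ ∈ baseOf (shearGr b p₁ p₂ L s).toSubmodule := by
    -- Exchanging p₁ and p₂ changes the sign of the shear, which replacing s by -s undoes.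
    have h := mem_baseOf_shearGr hK hnd hsymm (s := -s) hL (neg_ne_zero.2 hs)
      (notMem_of_finrank_sup (by rwa [Set.pair_comm] at hd))
    simpa only [shearGr, shear_swap p₁ p₂, smul_neg, neg_smul, neg_neg] using h
  refine le_antisymm (baseOf_shearGr_le _ _ _ _) (sup_le ?_ (Submodule.span_le.2 ?_))
  · rintro _ ⟨x, hx, rfl⟩
    have h3 : x.1 + s • (b x.2 p₁ • p₂ - b x.2 p₂ • p₁) ∈
        baseOf (shearGr b p₁ p₂ L s).toSubmodule := ⟨_, ⟨x, hx, rfl⟩, rfl⟩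
    have h4 : s • (b x.2 p₁ • p₂ - b x.2 p₂ • p₁) ∈ baseOf (shearGr b p₁ p₂ L s).toSubmodule :=
      Submodule.smul_mem _ _ (sub_mem (Submodule.smul_mem _ _ h2) (Submodule.smul_mem _ _ h1))
    have := sub_mem h3 h4
    rwa [add_sub_cancel_right] at this
  · rintro x (rfl | rfl)
    · exact h1
    · exact h2

theorem exists_codim_two (F : Submodule K V) (h : 2 ≤ finrank K F) :
    ∃ (F' : Submodule K V) (p₁ p₂ : V), F' ⊔ Submodule.span K {p₁, p₂} = F ∧
      finrank K F = finrank K F' + 2 := by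
  obtain ⟨f, hf⟩ := exists_linearIndependent_of_le_finrank h
  have hf' : LinearIndependent K (fun i => (f i : V)) :=
    hf.map' F.subtype F.ker_subtype
  set P := Submodule.span K (Set.range fun i => (f i : V)) with hP
  have hPd : finrank K P = 2 := by
    rw [hP, finrank_span_eq_card hf', Fintype.card_fin]
  have hPF : P ≤ F := Submodule.span_le.2 (by rintro _ ⟨i, rfl⟩; exact (f i).2)
  have hP2 : P = Submodule.span K {(f 0 : V), (f 1 : V)} := by
    rw [hP]
    congr 1
    ext x
    simp [Fin.exists_fin_two, eq_comm]
  obtain ⟨C, hC⟩ := Submodule.exists_isCompl P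
  have hsup : (F ⊓ C) ⊔ P = F := by
    rw [inf_sup_assoc_of_le C hPF, sup_comm, hC.sup_eq_top, inf_top_eq]
  refine ⟨F ⊓ C, f 0, f 1, by rw [← hP2, hsup], ?_⟩
  have h1 := Submodule.finrank_sup_add_finrank_inf_eq (F ⊓ C) P
  have h2 : (F ⊓ C) ⊓ P = ⊥ := by
    rw [inf_assoc, inf_comm C P, hC.inf_eq_bot, inf_bot_eq]
  rw [hsup, h2, finrank_bot, hPd] at h1
  omega

/-- Take M over a subspace of codimension two in π(L), with ω = 0. Its shear at s = 1 has the same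
projection as L, hence is joined to L inside a fiber; letting s run over the line joins it to M. The
bound on π(N) along the path keeps it in OΣ when L is there. -/
theorem exists_connectedThrough_descend [Infinite K] (hK : ringChar K ≠ 2) (hnd : b.Nondegenerate)
    (hsymm : b.IsSymm) {L : Gr K (finrank K V) (V × V)} (hL : L ∈ OGrEps b)
    (h2 : 2 ≤ finrank K (baseOf L.toSubmodule)) :
    ∃ M ∈ OGrEps b, finrank K (baseOf L.toSubmodule) = finrank K (baseOf M.toSubmodule) + 2 ∧
      baseOf M.toSubmodule ≤ baseOf L.toSubmodule ∧
      ConnectedThrough {N | N ∈ OGrEps b ∧ baseOf N.toSubmodule ≤ baseOf L.toSubmodule} L M := by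
  obtain ⟨F, p₁, p₂, hF, hd⟩ := exists_codim_two _ h2
  let M : Gr K (finrank K V) (V × V) := extGr hnd (⟨F, rfl⟩ : Gr K (finrank K F) V) 0
  have hM : M ∈ OGrEps b := extGr_mem_OGrEps hnd hsymm _ _
  have hMF : baseOf M.toSubmodule = F := baseOf_extGr hnd _ _
  have hFL : F ≤ baseOf L.toSubmodule := hF ▸ le_sup_left
  have hd' : finrank K (baseOf M.toSubmodule ⊔ Submodule.span K {p₁, p₂} : Submodule K V) =
      finrank K (baseOf M.toSubmodule) + 2 := by rw [hMF, hF, hd]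
  have hbase : baseOf L.toSubmodule = baseOf (shearGr b p₁ p₂ M 1).toSubmodule := by
    rw [baseOf_shearGr hK hnd hsymm hM one_ne_zero hd', hMF, hF]
  refine ⟨M, hM, by rw [hMF, hd], by rw [hMF]; exact hFL, ?_⟩
  have c1 := (connectedThrough_of_baseOf_eq hK hnd hsymm hL
    (shearGr_mem_OGrEps hsymm p₁ p₂ hM 1) hbase).mono
    (T := {N | N ∈ OGrEps b ∧ baseOf N.toSubmodule ≤ baseOf L.toSubmodule})
    fun N hN => ⟨hN.1, hN.2.le⟩
  have c2 := ConnectedThrough.of_line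
    (S := {N | N ∈ OGrEps b ∧ baseOf N.toSubmodule ≤ baseOf L.toSubmodule})
    (continuous_shearGr (b := b) p₁ p₂ M)
    (fun s => ⟨shearGr_mem_OGrEps hsymm p₁ p₂ hM s,
      (baseOf_shearGr_le p₁ p₂ M s).trans (by rw [hMF, hF])⟩) 1 0
  rw [shearGr_zero] at c2
  exact c1.trans c2

theorem exists_connectedThrough_small [Infinite K] (hK : ringChar K ≠ 2) (hnd : b.Nondegenerate)
    (hsymm : b.IsSymm) (k : ℕ) : ∀ {L : Gr K (finrank K V) (V × V)}, L ∈ OGrEps b →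
    finrank K (baseOf L.toSubmodule) = k →
    ∃ M ∈ OGrEps b, finrank K (baseOf M.toSubmodule) = k % 2 ∧
      baseOf M.toSubmodule ≤ baseOf L.toSubmodule ∧
      ConnectedThrough {N | N ∈ OGrEps b ∧ baseOf N.toSubmodule ≤ baseOf L.toSubmodule} L M := by
  induction k using Nat.strong_induction_on with
  | _ k ih =>
    intro L hL hk
    by_cases h2 : 2 ≤ k
    · obtain ⟨M, hM, hd, hML, hc⟩ := exists_connectedThrough_descend hK hnd hsymm hL (hk ▸ h2)
      obtain ⟨M', hM', hd', hML', hc'⟩ := ih (k - 2) (by omega) hM (by omega)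
      exact ⟨M', hM', by omega, hML'.trans hML,
        hc.trans (hc'.mono fun N hN => ⟨hN.1, hN.2.trans hML⟩)⟩
    · exact ⟨L, hL, by omega, le_rfl, .refl ⟨hL, le_rfl⟩⟩

/-! ### Families over lines -/

/-- The Lagrangian subspace `⟨x⟩ ⊕ ε ⟨x⟩^⊥`. -/
noncomputable def lineGr (hnd : b.Nondegenerate) (x : V) : Gr K (finrank K V) (V × V) :=
  extGr hnd (⟨Submodule.span K {x}, rfl⟩ : Gr K (finrank K (Submodule.span K {x})) V) 0

theorem lineGr_mem_OGrEps (hnd : b.Nondegenerate) (hsymm : b.IsSymm) (x : V) :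
    lineGr hnd x ∈ OGrEps b := extGr_mem_OGrEps hnd hsymm _ _

theorem baseOf_lineGr (hnd : b.Nondegenerate) (x : V) :
    baseOf (lineGr hnd x).toSubmodule = Submodule.span K {x} := baseOf_extGr hnd _ _

theorem connectedThrough_lineGr_of_span_eq [Infinite K] (hK : ringChar K ≠ 2)
    (hnd : b.Nondegenerate) (hsymm : b.IsSymm) {x y : V}
    (h : Submodule.span K {x} = Submodule.span K {y}) :
    ConnectedThrough {N | N ∈ OGrEps b ∧ baseOf N.toSubmodule = Submodule.span K {x}}
      (lineGr hnd x) (lineGr hnd y) := by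
  have := connectedThrough_of_baseOf_eq hK hnd hsymm (lineGr_mem_OGrEps hnd hsymm x)
    (lineGr_mem_OGrEps hnd hsymm y) (by rw [baseOf_lineGr, baseOf_lineGr, h])
  rwa [baseOf_lineGr] at this

/-- The lines `⟨x + s y + s² z⟩` form a connected family, if `y` and `z` lie in a hyperplane that
does not contain `x`. -/
theorem connectedThrough_lineGr_quadratic [Infinite K] (hK : ringChar K ≠ 2)
    (hnd : b.Nondegenerate) (hsymm : b.IsSymm) {x y z : V} {l : V →ₗ[K] K} (hx : l x ≠ 0)
    (hy : l y = 0) (hz : l z = 0) {S : Set (Gr K (finrank K V) (V × V))}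
    (hS : ∀ N ∈ OGrEps b, ∀ s : K,
      baseOf N.toSubmodule = Submodule.span K {x + s • y + (s * s) • z} → N ∈ S) (s t : K) :
    ConnectedThrough S (lineGr hnd (x + s • y + (s * s) • z))
      (lineGr hnd (x + t • y + (t * t) • z)) := by
  have hx0 : x ≠ 0 := by
    rintro rfl
    exact hx (map_zero l)
  have hc : IsCompl (Submodule.span K {x}) (LinearMap.ker l) := by
    constructor
    · rw [Submodule.disjoint_def]
      intro w hw hw'
      obtain ⟨c, rfl⟩ := Submodule.mem_span_singleton.1 hw
      rw [LinearMap.mem_ker, map_smul, smul_eq_mul] at hw'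
      rw [(mul_eq_zero.1 hw').resolve_right hx, zero_smul]
    · rw [codisjoint_iff, eq_top_iff]
      rintro w -
      refine Submodule.mem_sup.2 ⟨(l w / l x) • x,
        Submodule.smul_mem _ _ (Submodule.mem_span_singleton_self x), w - (l w / l x) • x, ?_, by simp⟩
      rw [LinearMap.mem_ker, map_sub, map_smul, smul_eq_mul, div_mul_cancel₀ _ hx, sub_self]
  let D : Splitting K 1 V := ⟨_, _, hc, finrank_span_singleton hx0⟩
  let x' : D.A := ⟨x, Submodule.mem_span_singleton_self x⟩
  let κ : D.A →ₗ[K] K := (LinearEquiv.coord K V x hx0).toLinearMap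
  have hκ : κ x' = 1 := LinearEquiv.coord_self K V x hx0
  let y' : D.B := ⟨y, hy⟩
  let z' : D.B := ⟨z, hz⟩
  let g : K → (D.A →ₗ[K] D.B) × (D.A [⋀^Fin 2]→ₗ[K] K) := fun s =>
    (LinearMap.smulRightₗ κ (0 + s • y' + (s * s) • z'), 0)
  have hg : IsPolyMap K g :=
    ((isPolyMap_quadratic 0 y' z').map (LinearMap.smulRightₗ κ)).prodMk (.const 0)
  have hbase : ∀ s, baseOf (extChart hnd D (g s)).toSubmodule =
      Submodule.span K {x + s • y + (s * s) • z} := by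
    intro s
    rw [baseOf_extChart]
    have h1 : D.graphMap (g s).1 x' = x + s • y + (s * s) • z := by
      rw [Splitting.graphMap_apply]
      simp [g, hκ, x', y', z', add_assoc]
    have h2 : (⊤ : Submodule K D.A) = Submodule.span K {x'} := by
      rw [eq_comm, eq_top_iff]
      rintro ⟨w, hw⟩ -
      obtain ⟨c, rfl⟩ := Submodule.mem_span_singleton.1 hw
      exact Submodule.mem_span_singleton.2 ⟨c, rfl⟩
    change LinearMap.range (D.graphMap (g s).1) = _
    rw [LinearMap.range_eq_map, h2, Submodule.map_span, Set.image_singleton, h1]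
  have hend : ∀ s, ConnectedThrough S (lineGr hnd (x + s • y + (s * s) • z))
      (extChart hnd D (g s)) := fun s => by
    have := connectedThrough_of_baseOf_eq hK hnd hsymm (lineGr_mem_OGrEps hnd hsymm _)
      (extChart_mem_OGrEps hnd hsymm D (g s)) ((baseOf_lineGr hnd _).trans (hbase s).symm)
    refine this.mono fun N hN => hS N hN.1 s ?_
    rw [hN.2, baseOf_lineGr]
  exact (hend s).trans ((ConnectedThrough.of_line (continuous_extChart_comp hnd D hg)
    (fun s => hS _ (extChart_mem_OGrEps hnd hsymm D _) s (hbase s)) s t).trans (hend t).symm)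

/-- Independent lines ⟨x⟩ and ⟨y⟩ are both joined to ⟨x + y⟩, by the families x + sy and y + sx. -/
theorem connectedThrough_lineGr [Infinite K] (hK : ringChar K ≠ 2)
    (hnd : b.Nondegenerate) (hsymm : b.IsSymm) {x y : V} (hx : x ≠ 0) (hy : y ≠ 0) :
    ConnectedThrough (OGrEps b) (lineGr hnd x) (lineGr hnd y) := by
  have half : ∀ {x y : V}, x ∉ Submodule.span K {y} →
      ConnectedThrough (OGrEps b) (lineGr hnd x) (lineGr hnd (x + y)) := by
    intro x y h
    obtain ⟨l, hl, hl'⟩ := Submodule.exists_le_ker_of_notMem h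
    have := connectedThrough_lineGr_quadratic hK hnd hsymm (S := OGrEps b) hl
      (hl' (Submodule.mem_span_singleton_self y)) (map_zero l) (fun N hN _ _ => hN) 0 1
    simpa using this
  by_cases h : x ∈ Submodule.span K {y}
  · refine (connectedThrough_lineGr_of_span_eq hK hnd hsymm ?_).mono fun N hN => hN.1
    obtain ⟨c, rfl⟩ := Submodule.mem_span_singleton.1 h
    exact Submodule.span_singleton_smul_eq
      (IsUnit.mk0 c (by rintro rfl; exact hx (zero_smul K y))) y
  · have h' : y ∉ Submodule.span K {x} := by
      intro hyx
      obtain ⟨c, rfl⟩ := Submodule.mem_span_singleton.1 hyx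
      refine h (Submodule.mem_span_singleton.2 ⟨c⁻¹, ?_⟩)
      rw [smul_smul, inv_mul_cancel₀ (by rintro rfl; exact hy (zero_smul K x)), one_smul]
    have := half h'
    rw [add_comm] at this
    exact (half h).trans this.symm

theorem mem_OSigma_of_baseOf_isotropic (hK : ringChar K ≠ 2) (hnd : b.Nondegenerate)
    (hsymm : b.IsSymm) {N : Gr K (finrank K V) (V × V)} (hN : N ∈ OGrEps b) {x : V}
    (hx : b x x = 0) (h : baseOf N.toSubmodule = Submodule.span K {x}) : N ∈ OSigma b := by
  rw [mem_OSigma_iff_baseOf hK hnd hsymm hN, h]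
  intro y hy z hz
  obtain ⟨c, rfl⟩ := Submodule.mem_span_singleton.1 hy
  obtain ⟨d, rfl⟩ := Submodule.mem_span_singleton.1 hz
  simp [hx]

/-- Let P be the hyperbolic plane ⟨x, y⟩. If P^⊥ were totally isotropic, then P^⊥ ⊆ P^⊥⊥ = P, and a
vector of P orthogonal to x and y vanishes. But P^⊥ ≠ 0, since r ≥ 3. -/
theorem exists_anisotropic_orthogonal (hK : ringChar K ≠ 2) (hnd : b.Nondegenerate)
    (hsymm : b.IsSymm) (hr : 3 ≤ finrank K V) {x y : V} (hx : b x x = 0) (hy : b y y = 0)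
    (hxy : b x y ≠ 0) : ∃ z, b x z = 0 ∧ b y z = 0 ∧ b z z ≠ 0 := by
  by_contra! hcon
  set P := Submodule.span K {x, y}
  have hmem : ∀ z, z ∈ b.orthogonal P ↔ b x z = 0 ∧ b y z = 0 := by
    intro z
    constructor
    · intro h
      exact ⟨h x (Submodule.subset_span (by simp)), h y (Submodule.subset_span (by simp))⟩
    · rintro ⟨h1, h2⟩ w hw
      obtain ⟨α, β, rfl⟩ := Submodule.mem_span_pair.1 hw
      change b (α • x + β • y) z = 0
      simp [h1, h2]
  have hP : finrank K P ≤ 2 := by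
    have := finrank_span_finset_le_card (R := K) ({x, y} : Set V).toFinite.toFinset
    have h2 : ({x, y} : Set V).toFinite.toFinset.card ≤ 2 := by
      classical
      have : ({x, y} : Set V).toFinite.toFinset = {x, y} := by ext; simp
      rw [this]
      exact Finset.card_le_two
    rw [Set.Finite.coe_toFinset] at this
    exact this.trans h2
  have h1 := finrank_add_finrank_orthogonal_eq hnd P
  obtain ⟨z, hz, hz0⟩ := (Submodule.ne_bot_iff _).1
    (Submodule.one_le_finrank_iff.1 (by omega : 1 ≤ finrank K (b.orthogonal P)))
  have hpol := OGr_polar hK hsymm (F := b.orthogonal P)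
    (fun w hw => hcon w ((hmem w).1 hw).1 ((hmem w).1 hw).2)
  have hzP : z ∈ P := by
    rw [← LinearMap.BilinForm.orthogonal_orthogonal hnd hsymm.isRefl P]
    exact fun w hw => hpol w hw z hz
  obtain ⟨α, β, rfl⟩ := Submodule.mem_span_pair.1 hzP
  obtain ⟨h2, h3⟩ := (hmem _).1 hz
  simp only [map_add, map_smul, smul_eq_mul, hx, hy, hsymm.eq y x, mul_zero, zero_add,
    add_zero, mul_eq_zero, hxy, or_false] at h2 h3
  simp [h2, h3] at hz0

/-- The points x + sz - s²κy, with κ = b(z, z) / 2b(x, y), trace the conic of isotropic lines in ⟨x,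
y, z⟩. This parametrization misses ⟨y⟩, so a second one starting at y is used, and the two are
compared at a common point. -/
theorem connectedThrough_lineGr_of_not_orthogonal [Infinite K] (hK : ringChar K ≠ 2)
    (hnd : b.Nondegenerate) (hsymm : b.IsSymm) (hr : 3 ≤ finrank K V) {x y : V} (hx : b x x = 0)
    (hy : b y y = 0) (hxy : b x y ≠ 0) :
    ConnectedThrough (OSigma b) (lineGr hnd x) (lineGr hnd y) := by
  obtain ⟨z, hxz, hyz, hzz⟩ := exists_anisotropic_orthogonal hK hnd hsymm hr hx hy hxy
  have h2 : (2 : K) ≠ 0 := Ring.two_ne_zero hK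
  have half : ∀ {x y : V}, b x x = 0 → b y y = 0 → b x y ≠ 0 → b x z = 0 → b y z = 0 →
      ∀ s : K, ConnectedThrough (OSigma b) (lineGr hnd x)
        (lineGr hnd (x + s • z + (s * s) • (-(b z z / (2 * b x y)) • y))) := by
    intro x y hx hy hxy hxz hyz s
    have := connectedThrough_lineGr_quadratic hK hnd hsymm (S := OSigma b) (x := x) (y := z)
      (z := -(b z z / (2 * b x y)) • y) (l := b y) (by rwa [hsymm.eq]) hyz (by simp [hy])
      (fun N hN t ht => mem_OSigma_of_baseOf_isotropic hK hnd hsymm hN ?_ ht) 0 s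
    · simpa using this
    · simp only [map_add, map_smul, LinearMap.add_apply, LinearMap.smul_apply, smul_eq_mul, hx, hy,
        hxz, hyz, hsymm.eq z x, hsymm.eq z y, hsymm.eq y x]
      field_simp
      ring
  set κ := b z z / (2 * b x y) with hκ
  have hκ0 : κ ≠ 0 := div_ne_zero hzz (mul_ne_zero h2 hxy)
  have c1 := half hx hy hxy hxz hyz 1
  -- The parameter -κ⁻¹ from y gives the same line as the parameter 1 from x: the two vectors differ
  -- by the factor -κ⁻¹.
  have c2 := half hy hx (by rwa [hsymm.eq]) hyz hxz (-κ⁻¹)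
  rw [hsymm.eq y x, ← hκ] at c2
  rw [← hκ] at c1
  have e : y + -κ⁻¹ • z + (-κ⁻¹ * -κ⁻¹) • (-κ • x) =
      (-κ⁻¹) • (x + (1 : K) • z + ((1 : K) * 1) • (-κ • y)) := by
    simp only [smul_add, smul_smul]
    rw [show -κ⁻¹ * -κ⁻¹ * -κ = -κ⁻¹ by field_simp, show -κ⁻¹ * (1 * 1 * -κ) = 1 by field_simp,
      mul_one, one_smul]
    abel
  rw [e] at c2
  refine c1.trans (ConnectedThrough.trans ?_ c2.symm)
  refine (connectedThrough_lineGr_of_span_eq hK hnd hsymm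
    (Submodule.span_singleton_smul_eq (IsUnit.mk0 _ (neg_ne_zero.2 (inv_ne_zero hκ0))) _).symm).mono
    fun N hN => mem_OSigma_of_baseOf_isotropic hK hnd hsymm hN.1 ?_ hN.2
  simp only [map_add, map_smul, LinearMap.add_apply, LinearMap.smul_apply, smul_eq_mul, hx, hy,
    hxz, hyz, hsymm.eq z x, hsymm.eq z y, hsymm.eq y x, hκ]
  field_simp
  ring

/-- If x and y are orthogonal, pass through an isotropic w orthogonal to neither. Since V is not the
union of the hyperplanes x^⊥ and y^⊥, some u avoids both; subtracting a multiple of x makes u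
isotropic without changing its products with x and y. -/
theorem connectedThrough_lineGr_isotropic [Infinite K] (hK : ringChar K ≠ 2)
    (hnd : b.Nondegenerate) (hsymm : b.IsSymm) (hr : 3 ≤ finrank K V) {x y : V} (hx0 : x ≠ 0)
    (hy0 : y ≠ 0) (hx : b x x = 0) (hy : b y y = 0) :
    ConnectedThrough (OSigma b) (lineGr hnd x) (lineGr hnd y) := by
  have h2 : (2 : K) ≠ 0 := Ring.two_ne_zero hK
  by_cases hxy : b x y = 0
  · have hex : ∀ x : V, x ≠ 0 → ∃ u, b u x ≠ 0 := by
      intro x hx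
      by_contra! h
      exact hx (hnd.2 x h)
    obtain ⟨u, hux, huy⟩ : ∃ u, b u x ≠ 0 ∧ b u y ≠ 0 := by
      obtain ⟨c, hc⟩ := hex x hx0
      obtain ⟨d, hd⟩ := hex y hy0
      by_cases h1 : b c y = 0
      · by_cases h2 : b d x = 0
        · exact ⟨c + d, by simpa [h2] using hc, by simpa [h1] using hd⟩
        · exact ⟨d, h2, hd⟩
      · exact ⟨c, hc, h1⟩
    set w := u - (b u u / (2 * b u x)) • x with hw
    have hww : b w w = 0 := by
      simp only [hw, map_sub, map_smul, LinearMap.sub_apply, LinearMap.smul_apply, smul_eq_mul, hx,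
        hsymm.eq x u]
      field_simp
      ring
    have hxw : b x w ≠ 0 := by
      simpa [hw, hx, hsymm.eq x u] using hux
    have hwy : b w y ≠ 0 := by
      simpa [hw, hxy] using huy
    exact (connectedThrough_lineGr_of_not_orthogonal hK hnd hsymm hr hx hww hxw).trans
      (connectedThrough_lineGr_of_not_orthogonal hK hnd hsymm hr hww hy hwy)
  · exact connectedThrough_lineGr_of_not_orthogonal hK hnd hsymm hr hx hy hxy

end Families

end LagrangianDual

namespace LagrangianDual

open Module

/-! ### Connected components of the orthogonal Grassmannian and of OΣ -/

section Components

variable {K : Type u} [Field K] {V : Type v} [AddCommGroup V] [Module K V]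
variable [FiniteDimensional K V] {b : LinearMap.BilinForm K V}

theorem finrank_baseOf_parity_eq (hK : ringChar K ≠ 2) (hnd : b.Nondegenerate) (hsymm : b.IsSymm)
    {T : Set (Gr K (finrank K V) (V × V))} (hT : IsPreconnected T) (hTS : T ⊆ OGrEps b)
    {L M : Gr K (finrank K V) (V × V)} (hL : L ∈ T) (hM : M ∈ T) :
    finrank K (baseOf L.toSubmodule) % 2 = finrank K (baseOf M.toSubmodule) % 2 := by
  refine hT.constant (f := fun L => finrank K (baseOf L.toSubmodule) % 2) (fun N hN => ?_) hL hM
  obtain ⟨U, hU, hNU, h⟩ := exists_open_parity hK hnd hsymm (hTS hN)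
  refine (continuousWithinAt_const (b := finrank K (baseOf N.toSubmodule) % 2)).congr_of_eventuallyEq
    ?_ rfl
  filter_upwards [self_mem_nhdsWithin, mem_nhdsWithin_of_mem_nhds (hU.mem_nhds hNU)] with M hM hMU
  exact h M hMU (hTS hM)

theorem connectedComponentIn_eq_parity (hK : ringChar K ≠ 2) (hnd : b.Nondegenerate)
    (hsymm : b.IsSymm) {S : Set (Gr K (finrank K V) (V × V))} (hS : S ⊆ OGrEps b)
    {L : Gr K (finrank K V) (V × V)} (hL : L ∈ S)
    (h : ∀ M ∈ S, finrank K (baseOf M.toSubmodule) % 2 = finrank K (baseOf L.toSubmodule) % 2 →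
      ConnectedThrough S L M) :
    connectedComponentIn S L =
      {M | M ∈ S ∧ finrank K (baseOf M.toSubmodule) % 2 = finrank K (baseOf L.toSubmodule) % 2} := by
  ext M
  constructor
  · intro hM
    have hsub := connectedComponentIn_subset S L
    exact ⟨hsub hM, finrank_baseOf_parity_eq hK hnd hsymm isPreconnected_connectedComponentIn
      (hsub.trans hS) hM (mem_connectedComponentIn hL)⟩
  · rintro ⟨hM, hML⟩
    exact (h M hM hML).mem_connectedComponentIn

theorem exists_lineGr_eq (hnd : b.Nondegenerate) {L : Gr K (finrank K V) (V × V)}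
    (h : finrank K (baseOf L.toSubmodule) = 1) :
    ∃ x ≠ 0, baseOf L.toSubmodule = baseOf (lineGr hnd x).toSubmodule := by
  obtain ⟨x, hx, hxs⟩ := finrank_eq_one_iff'.1 h
  refine ⟨x, fun h0 => hx (Subtype.ext h0), ?_⟩
  rw [baseOf_lineGr]
  refine le_antisymm (fun y hy => ?_) ?_
  · obtain ⟨c, hc⟩ := hxs ⟨y, hy⟩
    exact Submodule.mem_span_singleton.2 ⟨c, congrArg Subtype.val hc⟩
  · exact (Submodule.span_singleton_le_iff_mem _ _).2 x.2

/-- Points of equal parity are connected in `S`, as soon as `S` contains every Lagrangian subspace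
whose projection is contained in that of a point of `S` and lines in `S` are connected. -/
theorem connectedThrough_of_parity_eq [Infinite K] (hK : ringChar K ≠ 2) (hnd : b.Nondegenerate)
    (hsymm : b.IsSymm) {S : Set (Gr K (finrank K V) (V × V))} (hS : S ⊆ OGrEps b)
    (hdown : ∀ L ∈ S, ∀ M ∈ OGrEps b, baseOf M.toSubmodule ≤ baseOf L.toSubmodule → M ∈ S)
    {m : ℕ} (hline : m % 2 = 1 → ∀ x y : V, x ≠ 0 → y ≠ 0 → lineGr hnd x ∈ S → lineGr hnd y ∈ S →
      ConnectedThrough S (lineGr hnd x) (lineGr hnd y))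
    {L M : Gr K (finrank K V) (V × V)} (hL : L ∈ S) (hM : M ∈ S)
    (hLm : finrank K (baseOf L.toSubmodule) % 2 = m % 2)
    (hMm : finrank K (baseOf M.toSubmodule) % 2 = m % 2) : ConnectedThrough S L M := by
  obtain ⟨L', hL', hLd, hLL', hLc⟩ := exists_connectedThrough_small hK hnd hsymm _ (hS hL) rfl
  obtain ⟨M', hM', hMd, hMM', hMc⟩ := exists_connectedThrough_small hK hnd hsymm _ (hS hM) rfl
  replace hLc := hLc.mono fun N hN => hdown L hL N hN.1 hN.2
  replace hMc := hMc.mono fun N hN => hdown M hM N hN.1 hN.2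
  refine hLc.trans (ConnectedThrough.trans ?_ hMc.symm)
  have hL'S := hdown L hL L' hL' hLL'
  have hM'S := hdown M hM M' hM' hMM'
  have same : ∀ {P Q : Gr K (finrank K V) (V × V)}, P ∈ S → Q ∈ OGrEps b →
      baseOf P.toSubmodule = baseOf Q.toSubmodule → ConnectedThrough S P Q := fun hP hQ h =>
    (connectedThrough_of_baseOf_eq hK hnd hsymm (hS hP) hQ h).mono
      fun N hN => hdown _ hP N hN.1 hN.2.le
  rcases Nat.mod_two_eq_zero_or_one m with h0 | h1
  -- In even parity both descents end at projection 0, so no lines have to be connected.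
  · refine same hL'S hM' ?_
    rw [Submodule.finrank_eq_zero.1 (hLd.trans (hLm.trans h0)),
      Submodule.finrank_eq_zero.1 (hMd.trans (hMm.trans h0))]
  · obtain ⟨x, hx, hxL⟩ := exists_lineGr_eq hnd (hLd.trans (hLm.trans h1))
    obtain ⟨y, hy, hyM⟩ := exists_lineGr_eq hnd (hMd.trans (hMm.trans h1))
    have hxS := hdown _ hL'S _ (lineGr_mem_OGrEps hnd hsymm x) hxL.ge
    have hyS := hdown _ hM'S _ (lineGr_mem_OGrEps hnd hsymm y) hyM.ge
    exact (same hL'S (hS hxS) hxL).trans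
      ((hline h1 x y hx hy hxS hyS).trans (same hM'S (hS hyS) hyM).symm)

theorem OGrEps_component [Infinite K] (hK : ringChar K ≠ 2) (hnd : b.Nondegenerate)
    (hsymm : b.IsSymm) {L : Gr K (finrank K V) (V × V)} (hL : L ∈ OGrEps b) :
    connectedComponentIn (OGrEps b) L = {M | M ∈ OGrEps b ∧
      finrank K (baseOf M.toSubmodule) % 2 = finrank K (baseOf L.toSubmodule) % 2} :=
  connectedComponentIn_eq_parity hK hnd hsymm subset_rfl hL fun _ hM h =>
    connectedThrough_of_parity_eq hK hnd hsymm subset_rfl (fun _ _ _ hN _ => hN)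
      (m := finrank K (baseOf L.toSubmodule))
      (fun _ _ _ hx hy _ _ => connectedThrough_lineGr hK hnd hsymm hx hy) hL hM rfl h

/-- OΣ is stable under shrinking π(L), since subspaces of isotropic subspaces are isotropic. Only
odd parity needs r ≥ 3, for connecting isotropic lines. -/
theorem OSigma_component [Infinite K] (hK : ringChar K ≠ 2) (hnd : b.Nondegenerate)
    (hsymm : b.IsSymm) {L : Gr K (finrank K V) (V × V)} (hL : L ∈ OSigma b)
    (hr : finrank K (baseOf L.toSubmodule) % 2 = 0 ∨ 3 ≤ finrank K V) :
    connectedComponentIn (OSigma b) L = {M | M ∈ OSigma b ∧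
      finrank K (baseOf M.toSubmodule) % 2 = finrank K (baseOf L.toSubmodule) % 2} := by
  have hS : OSigma b ⊆ OGrEps b := fun _ h => h.1
  refine connectedComponentIn_eq_parity hK hnd hsymm hS hL fun M hM h =>
    connectedThrough_of_parity_eq hK hnd hsymm hS (fun N hN P hP hPN => ?_)
      (m := finrank K (baseOf L.toSubmodule)) (fun hm x y hx hy hxS hyS => ?_) hL hM rfl h
  · have := (mem_OSigma_iff_baseOf hK hnd hsymm hN.1).1 hN
    exact (mem_OSigma_iff_baseOf hK hnd hsymm hP).2
      fun x hx y hy => this x (hPN hx) y (hPN hy)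
  · have iso : ∀ x, lineGr hnd x ∈ OSigma b → b x x = 0 := fun x hx => by
      have hmem : x ∈ baseOf (lineGr hnd x).toSubmodule := by
        rw [baseOf_lineGr]
        exact Submodule.mem_span_singleton_self x
      exact (mem_OSigma_iff_baseOf hK hnd hsymm hx.1).1 hx x hmem x hmem
    exact connectedThrough_lineGr_isotropic hK hnd hsymm (by omega) hx hy (iso x hxS) (iso y hyS)

omit [FiniteDimensional K V] in
theorem baseOf_epsV : baseOf (epsV K V).toSubmodule = ⊥ := by
  rw [eq_bot_iff]
  rintro _ ⟨_, ⟨c, rfl⟩, rfl⟩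
  rfl

omit [FiniteDimensional K V] in
theorem epsV_mem_OSigma : epsV K V ∈ OSigma b := by
  constructor
  · rintro _ ⟨c, rfl⟩
    simp [q₂_snd]
  · rintro _ ⟨_, ⟨c, rfl⟩, rfl⟩
    exact ⟨0, by simp [eps]⟩

theorem OGrComp_eq [Infinite K] (hK : ringChar K ≠ 2) (hnd : b.Nondegenerate)
    (hsymm : b.IsSymm) (m : Fin 2) :
    OGrComp b m = {L | L ∈ OGrEps b ∧ finrank K (baseOf L.toSubmodule) % 2 = m} := by
  have h := OGrEps_component hK hnd hsymm (epsV_mem_OSigma (b := b)).1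
  rw [baseOf_epsV, finrank_bot] at h
  fin_cases m
  · exact h
  · change OGrEps b \ _ = _
    rw [h]
    ext L
    refine and_congr_right fun hL => ?_
    have := Nat.mod_two_eq_zero_or_one (finrank K (baseOf L.toSubmodule))
    simp only [Set.mem_ofPred_eq, hL, true_and]
    change ¬ (_ = 0) ↔ _ = 1
    omega

theorem OSigmaComp_eq [Infinite K] (hK : ringChar K ≠ 2) (hnd : b.Nondegenerate)
    (hsymm : b.IsSymm) (m : Fin 2) :
    OSigmaComp b m = {L | L ∈ OSigma b ∧ finrank K (baseOf L.toSubmodule) % 2 = m} := by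
  rw [OSigmaComp, OGrComp_eq hK hnd hsymm]
  ext L
  exact ⟨fun h => ⟨h.1, h.2.2⟩, fun h => ⟨h.1, h.1.1, h.2⟩⟩

end Components

/-! ### Closures of the strata -/

section Closures

variable {K : Type u} [Field K] {V : Type v} [AddCommGroup V] [Module K V]
variable [FiniteDimensional K V] {b : LinearMap.BilinForm K V}

theorem two_mul_finrank_le (hnd : b.Nondegenerate) {F : Submodule K V}
    (hF : ∀ x ∈ F, ∀ y ∈ F, b x y = 0) : 2 * finrank K F ≤ finrank K V := by
  have h1 := finrank_add_finrank_orthogonal_eq hnd F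
  have h2 : F ≤ b.orthogonal F := fun x hx y hy => hF y hy x hx
  have h3 := Submodule.finrank_mono h2
  omega

theorem finrank_sup_span_singleton {F : Submodule K V} {p : V} (hp : p ∉ F) :
    finrank K (F ⊔ Submodule.span K {p} : Submodule K V) = finrank K F + 1 := by
  have h1 := Submodule.finrank_sup_add_finrank_inf_eq F (Submodule.span K {p})
  have h2 : F ⊓ Submodule.span K {p} = ⊥ := by
    rw [eq_bot_iff]
    rintro x ⟨hx, hx'⟩
    obtain ⟨c, rfl⟩ := Submodule.mem_span_singleton.1 hx'
    by_cases hc : c = 0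
    · simp [hc]
    · exact absurd ((Submodule.smul_mem_iff _ hc).1 hx) hp
  have h3 : p ≠ 0 := by
    rintro rfl
    exact hp F.zero_mem
  rw [h2, finrank_bot, finrank_span_singleton h3] at h1
  exact h1

/-- An isotropic subspace that is not of maximal dimension extends by an isotropic vector. -/
theorem exists_isotropic_extension [IsAlgClosed K] (hK : ringChar K ≠ 2) (hnd : b.Nondegenerate)
    (hsymm : b.IsSymm) {F : Submodule K V} (hF : ∀ x ∈ F, b x x = 0)
    (hr : 2 * (finrank K F + 1) ≤ finrank K V) :
    ∃ p ∉ F, ∀ x ∈ F ⊔ Submodule.span K {p}, b x x = 0 := by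
  have hpol := OGr_polar hK hsymm hF
  obtain ⟨C, hC⟩ := Submodule.exists_isCompl F
  have hFo : F ≤ b.orthogonal F := fun x hx y hy => hpol y hy x hx
  -- The dimension is at least 2(r - dim F) - r = r - 2 dim F ≥ 2. On two independent vectors the
  -- form is a binary quadratic form, which has a nontrivial zero over an algebraically closed
  -- field.
  have hdim : 2 ≤ finrank K (b.orthogonal F ⊓ C : Submodule K V) := by
    have h1 := finrank_add_finrank_orthogonal_eq hnd F
    have h2 := Submodule.finrank_sup_add_finrank_inf_eq (b.orthogonal F) C
    have h3 := Submodule.finrank_add_eq_of_isCompl hC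
    have h4 := (b.orthogonal F ⊔ C).finrank_le
    omega
  obtain ⟨f, hf⟩ := exists_linearIndependent_of_le_finrank hdim
  obtain ⟨p, hp, hp0, hpp⟩ : ∃ p ∈ b.orthogonal F ⊓ C, p ≠ 0 ∧ b p p = 0 := by
    by_cases h0 : b (f 0) (f 0) = 0
    · exact ⟨f 0, (f 0).2, fun h => hf.ne_zero 0 (Subtype.ext h), h0⟩
    · have : NeZero (2 : K) := ⟨Ring.two_ne_zero hK⟩
      obtain ⟨s, hs⟩ := IsAlgClosed.exists_eq_mul_self
        (discrim (b (f 0) (f 0)) (2 * b (f 0) (f 1)) (b (f 1) (f 1)))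
      obtain ⟨t, ht⟩ := exists_quadratic_eq_zero h0 ⟨s, hs⟩
      refine ⟨t • (f 0 : V) + f 1, add_mem (Submodule.smul_mem _ _ (f 0).2) (f 1).2, fun h => ?_, ?_⟩
      · have h1 : t • f 0 + (1 : K) • f 1 = 0 := Subtype.ext (by simpa using h)
        have h2 := LinearIndependent.pair_iff.1
          (show LinearIndependent K ![f 0, f 1] by
            convert hf using 1
            ext i
            fin_cases i <;> rfl) t 1 h1
        exact one_ne_zero h2.2
      · simp only [map_add, map_smul, LinearMap.add_apply, LinearMap.smul_apply, smul_eq_mul,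
          hsymm.eq (f 1 : V) (f 0)]
        linear_combination ht
  refine ⟨p, fun h => hp0 (Submodule.disjoint_def.1 hC.disjoint p h hp.2), fun x hx => ?_⟩
  obtain ⟨y, hy, z, hz, rfl⟩ := Submodule.mem_sup.1 hx
  obtain ⟨c, rfl⟩ := Submodule.mem_span_singleton.1 hz
  have h1 : b y p = 0 := hp.1 y hy
  simp [hF y hy, hpp, h1, hsymm.eq p y]

/-- The bound on i leaves room to extend π(L) by two vectors p₁, p₂ with isotropic sum. The shear of
L by them lies in the stratum i + 2 for s ≠ 0 and equals L at s = 0, a limit point of the punctured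
line. -/
theorem OSigmaStratum_subset_closure [IsAlgClosed K] (hK : ringChar K ≠ 2)
    (hnd : b.Nondegenerate) (hsymm : b.IsSymm) {i : ℕ} (hi : 2 * (i + 2) ≤ finrank K V) :
    OSigmaStratum b i ⊆ closure (OSigmaStratum b (i + 2)) := by
  rintro L ⟨hL, hLi⟩
  have hiso := (mem_OSigma_iff_baseOf hK hnd hsymm hL.1).1 hL
  replace hLi : finrank K (baseOf L.toSubmodule) = i := hLi
  obtain ⟨p₁, hp₁, hF₁⟩ := exists_isotropic_extension hK hnd hsymm
    (fun x hx => hiso x hx x hx) (by omega)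
  have hd₁ := finrank_sup_span_singleton hp₁
  obtain ⟨p₂, hp₂, hF₂⟩ := exists_isotropic_extension hK hnd hsymm hF₁ (by omega)
  have hd₂ := finrank_sup_span_singleton hp₂
  rw [sup_assoc, ← Submodule.span_insert] at hF₂ hd₂
  have hmem : ∀ s : K, s ≠ 0 → shearGr b p₁ p₂ L s ∈ OSigmaStratum b (i + 2) := by
    intro s hs
    have hbase := baseOf_shearGr hK hnd hsymm hL.1 hs (p₁ := p₁) (p₂ := p₂) (by omega)
    have hd : finrank K (baseOf (shearGr b p₁ p₂ L s).toSubmodule) = i + 2 := by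
      rw [hbase]
      omega
    refine ⟨(mem_OSigma_iff_baseOf hK hnd hsymm (shearGr_mem_OGrEps hsymm _ _ hL.1 s)).2 ?_, hd⟩
    rw [hbase]
    exact OGr_polar hK hsymm hF₂
  let _ := zariski K K
  have h := image_closure_subset_closure_image (continuous_shearGr (b := b) p₁ p₂ L)
    ⟨0, zero_mem_closure_zariski_line, rfl⟩
  rw [shearGr_zero] at h
  refine closure_mono ?_ h
  rintro _ ⟨s, hs, rfl⟩
  exact hmem s hs

theorem OSigmaStratum_subset_closure_add [IsAlgClosed K] (hK : ringChar K ≠ 2)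
    (hnd : b.Nondegenerate) (hsymm : b.IsSymm) {i : ℕ} (k : ℕ)
    (hi : 2 * (i + 2 * k) ≤ finrank K V) :
    OSigmaStratum b i ⊆ closure (OSigmaStratum b (i + 2 * k)) := by
  induction k with
  | zero => exact subset_closure
  | succ k ih =>
    exact (ih (by omega)).trans (closure_minimal
      (OSigmaStratum_subset_closure hK hnd hsymm (by omega)) isClosed_closure)

/-- A limit point stays in the closed set OΣ. Local constancy of the parity and openness of dim π(L)
≥ l + 1 exclude all other strata. -/
theorem closure_OSigmaStratum [IsAlgClosed K] (hK : ringChar K ≠ 2)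
    (hnd : b.Nondegenerate) (hsymm : b.IsSymm) {l : ℕ} (hl : 2 * l ≤ finrank K V) :
    closure (OSigmaStratum b l) =
      ⋃ i ∈ {i : ℕ | i % 2 = l % 2 ∧ i ≤ l}, OSigmaStratum b i := by
  ext L
  simp only [Set.mem_iUnion, exists_prop]
  constructor
  · intro hL
    have h1 : L ∈ OSigma b :=
      closure_minimal (fun _ h => h.1) (isClosed_OSigma hK hnd hsymm) hL
    refine ⟨finrank K (baseOf L.toSubmodule), ⟨?_, ?_⟩, h1, rfl⟩
    · obtain ⟨U, hU, hLU, h⟩ := exists_open_parity hK hnd hsymm h1.1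
      obtain ⟨M, hMU, hM⟩ := mem_closure_iff.1 hL U hU hLU
      rw [← h M hMU hM.1.1]
      exact congrArg (· % 2) hM.2
    · by_contra hlt
      obtain ⟨M, hMU, hM⟩ := mem_closure_iff.1 hL _
        (Gr.isOpen_le_finrank_map (LinearMap.fst K V V) (l + 1)) (not_le.1 hlt)
      have h2 : finrank K (M.toSubmodule.map (LinearMap.fst K V V)) = l := hM.2
      have h3 : l + 1 ≤ finrank K (M.toSubmodule.map (LinearMap.fst K V V)) := hMU
      omega
  · rintro ⟨i, ⟨hi, hil⟩, hL⟩
    have e : l = i + 2 * ((l - i) / 2) := by omega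
    rw [e]
    exact OSigmaStratum_subset_closure_add hK hnd hsymm _ (by omega) hL

end Closures

end LagrangianDual

theorem mainTheorem3 {K : Type u} [Field K] [IsAlgClosed K] (hK : ringChar K ≠ 2)
    {V : Type v} [AddCommGroup V] [Module K V] [FiniteDimensional K V]
    (b : LinearMap.BilinForm K V) (hsymm : b.IsSymm) (hnd : b.Nondegenerate)
    (r : ℕ) (hr : Module.finrank K V = r) :
    -- `OGr⁽⁰⁾` and `OGr⁽¹⁾` are the two connected components of `OGr(r, V ⊕ εV)`
    (∀ m : Fin 2, m = 0 ∨ 1 ≤ r →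
      (OGrComp b m).Nonempty ∧ ∀ L ∈ OGrComp b m,
        connectedComponentIn (OGrEps b) L = OGrComp b m) ∧
    -- `OΣ⁽⁰⁾` and `OΣ⁽¹⁾` are the two connected components of `OΣ`
    (∀ m : Fin 2, m = 0 ∨ 3 ≤ r →
      (OSigmaComp b m).Nonempty ∧ ∀ L ∈ OSigmaComp b m,
        connectedComponentIn (OSigma b) L = OSigmaComp b m) ∧
    -- the decomposition of `OΣ⁽ᵐ⁾` into disjoint strata
    (∀ m : Fin 2,
      OSigmaComp b m = ⋃ i ∈ {i : ℕ | i % 2 = (m : ℕ) ∧ i ≤ r / 2}, OSigmaStratum b i) ∧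
    (∀ i j : ℕ, i ≠ j → Disjoint (OSigmaStratum b i) (OSigmaStratum b j)) ∧
    -- `OΣᵢ` is the total space of the vector bundle `Λ²S*` over `OGr(i, V)`
    (∀ i : ℕ, i ≤ r / 2 →
      ∃ e : {t : Σ F : Gr K i V, Alt2 F | t.1 ∈ OGr b i} ≃ OSigmaStratum b i,
        (∀ t, (e t).1.toSubmodule = extensionOf b t.1.1 t.1.2) ∧
        (∀ L, (e.symm L).1.1.toSubmodule = L.1.toSubmodule.map (LinearMap.fst K V V)) ∧
        IsAlgVectorBundle (Gr.atlas K (Module.finrank K V) (V × V)) (OSigmaStratum b i)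
          (Gr.atlas K i V) (OGr b i) (fun F => Alt2 F) e ∧
        IsBiregular (altAtlas K i V) (Gr.atlas K (Module.finrank K V) (V × V)) e) ∧
    -- the closures of the strata
    (∀ l : ℕ, l ≤ r / 2 →
      closure (OSigmaStratum b l) =
        ⋃ i ∈ {i : ℕ | i % 2 = l % 2 ∧ i ≤ l}, OSigmaStratum b i) := by
  have : Infinite K := IsAlgClosed.instInfinite
  subst hr
  refine ⟨fun m hm => ?_, fun m hm => ?_, fun m => ?_, fun i j hij => ?_, fun i _ => ?_,
    fun l hl => closure_OSigmaStratum hK hnd hsymm (by omega)⟩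
  · rw [OGrComp_eq hK hnd hsymm]
    constructor
    · fin_cases m
      · exact ⟨epsV K V, epsV_mem_OSigma.1, by rw [baseOf_epsV, finrank_bot]⟩
      · have h1 : 1 ≤ Module.finrank K V := hm.resolve_left (by decide)
        have : Nontrivial V := Module.finrank_pos_iff.1 h1
        obtain ⟨x, hx⟩ := exists_ne (0 : V)
        refine ⟨lineGr hnd x, lineGr_mem_OGrEps hnd hsymm x, ?_⟩
        rw [baseOf_lineGr, finrank_span_singleton hx]
    · rintro L ⟨hL, hLm⟩
      rw [OGrEps_component hK hnd hsymm hL, hLm]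
  · rw [OSigmaComp_eq hK hnd hsymm]
    constructor
    · fin_cases m
      · exact ⟨epsV K V, epsV_mem_OSigma, by rw [baseOf_epsV, finrank_bot]⟩
      · have h3 : 3 ≤ Module.finrank K V := hm.resolve_left (by decide)
        -- A point of odd parity in OΣ comes from any nonzero isotropic vector, obtained by
        -- extending the zero subspace.
        obtain ⟨p, hp, hpp⟩ := exists_isotropic_extension hK hnd hsymm (F := ⊥)
          (by rintro x rfl; simp) (by rw [finrank_bot]; omega)
        have hpp' : b p p = 0 :=
          hpp p (Submodule.mem_sup_right (Submodule.mem_span_singleton_self p))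
        refine ⟨lineGr hnd p, mem_OSigma_of_baseOf_isotropic hK hnd hsymm
          (lineGr_mem_OGrEps hnd hsymm p) hpp' (baseOf_lineGr hnd p), ?_⟩
        rw [baseOf_lineGr, finrank_span_singleton (by simpa using hp)]
    · rintro L ⟨hL, hLm⟩
      rw [OSigma_component hK hnd hsymm hL (hm.imp_left fun h => by rw [hLm, h]; rfl), hLm]
  · rw [OSigmaComp_eq hK hnd hsymm]
    ext L
    simp only [Set.mem_iUnion, exists_prop]
    constructor
    · rintro ⟨hL, hLm⟩
      -- Isotropic subspaces have dimension at most r / 2, so the strata listed exhaust OΣ.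
      have := two_mul_finrank_le hnd ((mem_OSigma_iff_baseOf hK hnd hsymm hL.1).1 hL)
      exact ⟨_, ⟨hLm, by omega⟩, hL, rfl⟩
    · rintro ⟨i, ⟨hi, -⟩, hL, hLi⟩
      exact ⟨hL, (congrArg (· % 2) hLi).trans hi⟩
  · exact Set.disjoint_left.2 fun L hL hL' => hij (hL.2.symm.trans hL'.2)
  · exact ⟨bundleEquiv hK hnd hsymm i, fun t => rfl, bundleEquiv_symm_base hK hnd hsymm,
      isAlgVectorBundle_bundleEquiv hK hnd hsymm, isBiregular_bundleEquiv hK hnd hsymm⟩
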